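/- For positive integers $l_1,\dots,l_r$ with $l_1\ge 2$ let $\zeta(l_1,\dots,l_r)=\sum_{k_1>\dots>k_r\ge 1}\frac{1}{k_1^{l_1}\cdots k_r^{l_r}}$ be the multiple zeta value, and let $$\zeta^t(l_1,\dots,l_r)=\sum_{\mathbf p=(l_1\Box l_2\Box\cdots\Box l_r),\ \Box\in\{\text{``,''},\,\text{``+''}\}}t^{\,r-\mathrm{dep}(\mathbf p)}\,\zeta(\mathbf p)\in\mathbb R[t]$$ be the interpolated multiple zeta value, where $\mathrm{dep}(\mathbf p)$ is the number of entries of $\mathbf p$. **Theorem.** Let $m,u\ge 2$, $p\ge 1$ and $n,v\ge 0$ be integers, and put $K=n+v+2$. For $\alpha=(\alpha_1,\dots,\alpha_K)$ with integers $\alpha_i\ge 0$, and $1\le k\le K-1$, write $$Z_k(\alpha)=\zeta^t(\alpha_1+1,\dots,\alpha_K+1)-t\,\zeta^t(\alpha_1+1,\dots,\alpha_{k-1}+1,\ \alpha_k+\alpha_{k+1}+2,\ \alpha_{k+2}+1,\dots,\alpha_K+1).$$ Then $$\zeta^t(m,\underbrace{p,\dots,p}_{n})\,\zeta^t(u,\underbrace{p,\dots,p}_{v})=\sum_{\substack{\alpha_1+\dots+\alpha_K=(n+v)(p-1)+m+u-2\\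 \alpha_1,\dots,\alpha_K\ge 0}}\bigl[S_1(\alpha)+S_2(\alpha)+S_3(\alpha)+S_4(\alpha)\bigr],$$ where $$S_1(\alpha)=\sum_{\substack{l_1+\dots+l_{q+1}=n+1\\ n_1+\dots+n_q=v+1}}\ \prod_{i=1}^{L_q+v+1}\binom{\alpha_i}{\beta_i}\prod_{j=L_q+v+3}^{K}\delta_{\alpha_j,p-1}\cdot Z_{K-l_{q+1}}(\alpha),$$ $$S_2(\alpha)=\sum_{\substack{l_1+\dots+l_{q}=n+1\\ n_1+\dots+n_q=v+1}}\ \prod_{i=1}^{n+N_{q-1}+1}\binom{\alpha_i}{\beta_i}\prod_{j=n+N_{q-1}+3}^{K}\delta_{\alpha_j,p-1}\cdot Z_{K-n_q}(\alpha),$$ $$S_3(\alpha)=\sum_{\substack{l_1+\dots+l_{q}=n+1\\ n_1+\dots+n_{q+1}=v+1}}\ \prod_{i=1}^{N_q+n+1}\binom{\alpha_i}{\gamma_i}\prod_{j=N_q+n+3}^{K}\delta_{\alpha_j,p-1}\cdot Z_{K-n_{q+1}}(\alpha),$$ $$S_4(\alpha)=\sum_{\substack{l_1+\dots+l_{q}=n+1\\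 n_1+\dots+n_q=v+1}}\ \prod_{i=1}^{v+L_{q-1}+1}\binom{\alpha_i}{\gamma_i}\prod_{j=v+L_{q-1}+3}^{K}\delta_{\alpha_j,p-1}\cdot Z_{K-l_q}(\alpha).$$ The inner sums run over all integers $q\ge1$ and all integers $l_i\ge1$, $n_j\ge1$ with the indicated sums; $L_j=l_1+\dots+l_j$, $N_j=n_1+\dots+n_j$, $L_0=N_0=0$; $\delta_{a,b}$ is Kronecker's delta; $\binom{a}{b}=0$ if $b<0$ or $b>a$. The numbers $\beta_i,\gamma_i$ are $$\beta_1=m-1,\qquad \gamma_1=u-1,$$ $$\beta_{L_j+N_j+1}=(L_j+N_j-1)(p-1)+m+u-2-\sum_{i=1}^{L_j+N_j}\alpha_i\quad(1\le j\le q),$$ $$\beta_{L_j+N_j+d}=p-1\quad(2\le d\le l_{j+1},\ 0\le j\le q),$$ $$\beta_{L_{j+1}+N_j+1}=(L_{j+1}+N_j-1)(p-1)+m+u-2-\sum_{i=1}^{L_{j+1}+N_j}\alpha_i,\qquad \beta_{L_{j+1}+N_j+d}=p-1\quad(2\le d\le n_{j+1},\ 0\le j\le q-1),$$ and $$\gamma_{L_j+N_j+1}=(L_j+N_j-1)(p-1)+m+u-2-\sum_{i=1}^{L_j+N_j}\alpha_i\quad(1\le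 j\le q),$$ $$\gamma_{L_j+N_j+d}=p-1\quad(2\le d\le n_{j+1},\ 0\le j\le q),$$ $$\gamma_{L_j+N_{j+1}+1}=(L_j+N_{j+1}-1)(p-1)+m+u-2-\sum_{i=1}^{L_j+N_{j+1}}\alpha_i,\qquad \gamma_{L_j+N_{j+1}+d}=p-1\quad(2\le d\le l_{j+1},\ 0\le j\le q-1).$$ (For $\alpha_1=0$ all coefficients vanish, because $\beta_1,\gamma_1\ge1$, and the corresponding terms are read as $0$.) Moreover, Euler's decomposition formula (the case $t=0$, $n=v=0$) holds: $$\zeta(m)\zeta(u)=\sum_{k=1}^{m}\binom{m+u-k-1}{u-1}\zeta(m+u-k,k)+\sum_{k=1}^{u}\binom{m+u-k-1}{m-1}\zeta(m+u-k,k).$$ -/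

import Mathlib

namespace InterpolatedMZV

/-- The multiple zeta value `ζ(l₁, …, lₙ)`: the sum of `1 / (m₁ ^ l₁ ⋯ mₙ ^ lₙ)` over all integers
`m₁ > m₂ > ⋯ > mₙ ≥ 1`. The series converges when all `lᵢ ≥ 1` and `l₁ ≥ 2`. -/
noncomputable def mzv (l : List ℕ) : ℝ :=
  ∑' m : {m : Fin l.length → ℕ // StrictAnti m ∧ ∀ i, 1 ≤ m i},
    ∏ i : Fin l.length, 1 / ((m.1 i : ℝ) ^ l.get i)

/-- All indices `(a □ l₁ □ ⋯ □ lₙ)`, where every box is either a comma or a plus sign. -/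
def boxFillingsCons : ℕ → List ℕ → List (List ℕ)
  | a, [] => [[a]]
  | a, b :: l => (boxFillingsCons b l).map (fun w => a :: w) ++ boxFillingsCons (a + b) l

/-- All indices `(l₁ □ l₂ □ ⋯ □ lₙ)`, where every box is either a comma or a plus sign, listed with
multiplicity (one entry for each of the `2 ^ (n - 1)` ways to fill the boxes). -/
def boxFillings : List ℕ → List (List ℕ)
  | [] => [[]]
  | a :: l => boxFillingsCons a l

/-- The interpolated multiple zeta value `ζᵗ(l) = ∑ₚ t ^ (dep l - dep p) ζ(p)`, a real polynomial
in the variable `t`, which is `Polynomial.X` here. -/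
noncomputable def imzv (l : List ℕ) : Polynomial ℝ :=
  ((boxFillings l).map fun w =>
    Polynomial.X ^ (l.length - w.length) * Polynomial.C (mzv w)).sum

/-- The binomial coefficient `a choose b` with an integer lower entry; it is `0` for `b < 0`
and for `b > a`. -/
def binom (a : ℕ) (b : ℤ) : ℕ := if 0 ≤ b then a.choose b.toNat else 0

/-- The `j`-th part of a composition, counted from `1`. -/
def part {N : ℕ} (c : Composition N) (j : ℕ) : ℕ := c.blocks.getD (j - 1) 0

/-- The set of all numbers `A j + B j + 1` with `0 ≤ j ≤ q` and `A (j + 1) + B j + 1`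
with `0 ≤ j ≤ q - 1`. -/
def blockStarts (A B : ℕ → ℕ) (q : ℕ) : Finset ℕ :=
  (Finset.range (q + 1)).image (fun j => A j + B j + 1) ∪
    (Finset.range q).image (fun j => A (j + 1) + B j + 1)

/-- The lower entries of the binomial coefficients. Here `A j`, `B j` are the partial sums of the
two compositions, the first of which describes the word that comes first, and `h` is the leading
entry of that word. The first entry is `h - 1`. At every other block start `i`, which is
`A j + B j + 1` or `A (j + 1) + B j + 1`, the entry is
`(i - 2) (p - 1) + (m + u) - 2 - (α₁ + ⋯ + αᵢ₋₁)`, and at all remaining places it is `p - 1`. -/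
def lowerEntry (A B : ℕ → ℕ) (q h m u p : ℕ) (α : ℕ → ℕ) (i : ℕ) : ℤ :=
  if i = 1 then (h : ℤ) - 1
  else if i ∈ blockStarts A B q then
    ((i : ℤ) - 2) * ((p : ℤ) - 1) + ((m : ℤ) + u) - 2 - ∑ k ∈ Finset.Icc 1 (i - 1), (α k : ℤ)
  else (p : ℤ) - 1

/-- The numbers `βᵢ` attached to compositions `l` of `n + 1` and `c` of `v + 1`; the partial sums
are `L j = l.sizeUpTo j` and `N j = c.sizeUpTo j`. -/
def beta {n v : ℕ} (l : Composition (n + 1)) (c : Composition (v + 1)) (q m u p : ℕ)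
    (α : ℕ → ℕ) : ℕ → ℤ :=
  lowerEntry l.sizeUpTo c.sizeUpTo q m m u p α

/-- The numbers `γᵢ` attached to compositions `l` of `n + 1` and `c` of `v + 1`. -/
def gamma {n v : ℕ} (l : Composition (n + 1)) (c : Composition (v + 1)) (q m u p : ℕ)
    (α : ℕ → ℕ) : ℕ → ℤ :=
  lowerEntry c.sizeUpTo l.sizeUpTo q u m u p α

/-- `∏_{i=1}^{M} (αᵢ choose bᵢ) * ∏_{j=M+2}^{K} δ_{αⱼ, p-1}`. -/
def coeff (K M p : ℕ) (b : ℕ → ℤ) (α : ℕ → ℕ) : ℕ :=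
  (∏ i ∈ Finset.Icc 1 M, binom (α i) (b i)) *
    ∏ j ∈ Finset.Icc (M + 2) K, if α j = p - 1 then 1 else 0

/-- The list `(αₐ + 1, …, α_b + 1)`. -/
def shifted (α : ℕ → ℕ) (a b : ℕ) : List ℕ := (List.Ico a (b + 1)).map fun i => α i + 1

/-- The index `(α₁ + 1, …, αₖ₋₁ + 1, αₖ + αₖ₊₁ + 2, αₖ₊₂ + 1, …, α_K + 1)`. -/
def merged (α : ℕ → ℕ) (K k : ℕ) : List ℕ :=
  shifted α 1 (k - 1) ++ (α k + α (k + 1) + 2) :: shifted α (k + 2) K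

/-- `ζᵗ(α₁ + 1, …, α_K + 1) - t ζᵗ(…, αₖ + αₖ₊₁ + 2, …)`. -/
noncomputable def corrected (α : ℕ → ℕ) (K k : ℕ) : Polynomial ℝ :=
  imzv (shifted α 1 K) - Polynomial.X * imzv (merged α K k)

end InterpolatedMZV

open InterpolatedMZV

/-!
The product formula is the shuffle product of two words, evaluated at `z = 1`.

Encode an index `(l₁, …, lᵣ)` by the word `x ^ (l₁ - 1) y ⋯ x ^ (lᵣ - 1) y`. The interpolated
polylogarithm `polylog t l` is the power series obtained from the word by letting `x` act as the
inverse of `z d/dz` (`integ`), and `y` as multiplication by `z / (1 - z) + t` followed by that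
inverse, except that the last letter stands for `z / (1 - z)` without `t`. Its coefficients sum to
`ζᵗ(l)` evaluated at `t` (`hasSum_coeff_polylog`). Since all series at `t = 0` have nonnegative
coefficients, products of values come from Cauchy products (`hasSum_coeff_mul`), and it suffices to
multiply formal power series.

Because `z d/dz` is a derivation, two such series multiply by a shuffle rule. Collecting the letters
`x` before the first letter `y` of the product gives a recursion with one binomial coefficient
(`integ_pow_mul_integ_pow`, `polylog_mul_polylog`). If that `y` is the last letter of its word, then
it acts as `z / (1 - z) = (z / (1 - z) + t) - t`, and the `-t` merges two neighbouring entries: this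
is the correction term in `Z_k` (`halfShuffle_innerSeries_nil`). Already this one step, at `t = 0`
and for words with a single `y`, is Euler's decomposition (`mzv_mul_mzv`).

It remains to see that the sum over pairs of compositions solves the recursion. A pair of
compositions with alternating blocks records from which word each letter `y` is taken. Removing the
first letter `y` either shortens the first block by one or, if that block has size `1`, exchanges
the roles of the words (`pairTerm_succ_cons`, `pairTerm_one_cons`). The lower entries of the
binomial coefficients follow along, once the initial numbers of letters `x` are allowed to be
arbitrary (`entry_consSeq`); these numbers can become negative, and such terms vanish
(`pairSum_eq_zero`). Induction on the number of letters `y` then gives `halfShuffle_eq_pairSum`.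
-/

namespace InterpolatedMZV

open scoped PowerSeries

/-! ### Formal multiple polylogarithms and their products -/

/-- The operator `z ^ n ↦ z ^ n / n` on formal power series; it kills constants, and on series
without constant term it is inverse to `z d/dz`. -/
noncomputable def integ : ℝ⟦X⟧ →ₗ[ℝ] ℝ⟦X⟧ where
  toFun f := PowerSeries.mk fun n => PowerSeries.coeff n f / n
  map_add' f g := by ext n; simp [add_div]
  map_smul' r f := by ext n; simp [mul_div_assoc]

/-- The series `z + z ^ 2 + z ^ 3 + ⋯`, that is, `z / (1 - z)`. -/
noncomputable def geom : ℝ⟦X⟧ := PowerSeries.mk fun n => if n = 0 then 0 else 1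

mutual

/-- The interpolated multiple polylogarithm in one variable, as a formal power series in `z`. For
`t = 0` and `l ≠ []` it is `∑ z ^ m₁ / (m₁ ^ l₁ ⋯ mᵣ ^ lᵣ)` over `m₁ > ⋯ > mᵣ ≥ 1`. The value at the
empty index is a convention. -/
noncomputable def polylog (t : ℝ) : List ℕ → ℝ⟦X⟧
  | [] => 1
  | k :: l => (integ ^ k) (innerSeries t l)

/-- The series `z / (1 - z)` if `l` is empty, and `(z / (1 - z) + t) Liᵗ(l)` otherwise. The
polylogarithm of `k :: l` arises from it by applying `integ` `k` times. -/
noncomputable def innerSeries (t : ℝ) : List ℕ → ℝ⟦X⟧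
  | [] => geom
  | k :: l => (geom + PowerSeries.C t) * polylog t (k :: l)

end

lemma polylog_cons (t : ℝ) (k : ℕ) (l : List ℕ) :
    polylog t (k :: l) = (integ ^ k) (innerSeries t l) := by
  rw [polylog]

lemma innerSeries_nil (t : ℝ) : innerSeries t [] = geom := by
  rw [innerSeries]

lemma innerSeries_cons (t : ℝ) (k : ℕ) (l : List ℕ) :
    innerSeries t (k :: l) = (geom + PowerSeries.C t) * polylog t (k :: l) := by
  rw [innerSeries]

lemma coeff_integ (n : ℕ) (f : ℝ⟦X⟧) :
    PowerSeries.coeff n (integ f) = PowerSeries.coeff n f / n := by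
  simp [integ]

lemma coeff_integ_pow (k n : ℕ) (f : ℝ⟦X⟧) :
    PowerSeries.coeff n ((integ ^ k) f) = PowerSeries.coeff n f / (n : ℝ) ^ k := by
  induction k with
  | zero => simp
  | succ k ih =>
    rw [pow_succ', Module.End.mul_apply, coeff_integ, ih, pow_succ, div_div]

lemma integ_pow_succ (k : ℕ) (f : ℝ⟦X⟧) : (integ ^ (k + 1)) f = integ ((integ ^ k) f) := by
  rw [pow_succ', Module.End.mul_apply]

lemma coeff_zero_geom : PowerSeries.coeff 0 geom = 0 := by simp [geom]

lemma coeff_zero_mul_left {f : ℝ⟦X⟧} (g : ℝ⟦X⟧) (hf : PowerSeries.coeff 0 f = 0) :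
    PowerSeries.coeff 0 (f * g) = 0 := by
  rw [PowerSeries.coeff_mul]; simp [hf]

lemma coeff_zero_mul_right (f : ℝ⟦X⟧) {g : ℝ⟦X⟧} (hg : PowerSeries.coeff 0 g = 0) :
    PowerSeries.coeff 0 (f * g) = 0 := by
  rw [mul_comm]; exact coeff_zero_mul_left f hg

lemma coeff_zero_integ_pow (k : ℕ) {f : ℝ⟦X⟧} (hf : PowerSeries.coeff 0 f = 0) :
    PowerSeries.coeff 0 ((integ ^ k) f) = 0 := by
  rw [coeff_integ_pow, hf, zero_div]

lemma coeff_zero_innerSeries (t : ℝ) (l : List ℕ) :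
    PowerSeries.coeff 0 (innerSeries t l) = 0 := by
  induction l with
  | nil => rw [innerSeries_nil]; exact coeff_zero_geom
  | cons k l ih =>
    rw [innerSeries_cons, polylog_cons]
    exact coeff_zero_mul_right _ (coeff_zero_integ_pow k ih)

/-- The derivation `z d/dz` on formal power series. -/
noncomputable def euler (f : ℝ⟦X⟧) : ℝ⟦X⟧ := PowerSeries.X * PowerSeries.derivative ℝ f

lemma coeff_euler (n : ℕ) (f : ℝ⟦X⟧) :
    PowerSeries.coeff n (euler f) = n * PowerSeries.coeff n f := by
  cases n with
  | zero => simp [euler]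
  | succ n =>
    rw [euler, PowerSeries.coeff_succ_X_mul, PowerSeries.coeff_derivative]
    push_cast; ring

lemma euler_mul (f g : ℝ⟦X⟧) : euler (f * g) = euler f * g + f * euler g := by
  simp only [euler, Derivation.leibniz, smul_eq_mul]; ring

lemma euler_integ {f : ℝ⟦X⟧} (hf : PowerSeries.coeff 0 f = 0) : euler (integ f) = f := by
  ext n
  rw [coeff_euler, coeff_integ]
  rcases eq_or_ne n 0 with rfl | hn
  · simp [hf]
  · field_simp

lemma integ_euler {f : ℝ⟦X⟧} (hf : PowerSeries.coeff 0 f = 0) : integ (euler f) = f := by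
  ext n
  rw [coeff_integ, coeff_euler]
  rcases eq_or_ne n 0 with rfl | hn
  · simp [hf]
  · field_simp

/-- Integration by parts. -/
lemma integ_mul_integ {f g : ℝ⟦X⟧} (hf : PowerSeries.coeff 0 f = 0)
    (hg : PowerSeries.coeff 0 g = 0) :
    integ f * integ g = integ (f * integ g) + integ (integ f * g) := by
  rw [← map_add, ← integ_euler (f := integ f * integ g), euler_mul, euler_integ hf, euler_integ hg]
  exact coeff_zero_mul_left _ (by simp [coeff_integ])

/-- The one-sided part of Euler's decomposition: the words of the shuffle product of
`x ^ (a + 1) f` and `x ^ (b + 1) g` in which `f` comes before `g`, collected by the number `α` of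
letters `x` in front of `f`. -/
noncomputable def halfShuffle (f g : ℝ⟦X⟧) (a b : ℕ) : ℝ⟦X⟧ :=
  ∑ α ∈ Finset.range (a + b + 1),
    (α.choose a : ℝ) • (integ ^ (α + 1)) (f * (integ ^ (a + b - α + 1)) g)

lemma halfShuffle_zero_left (f g : ℝ⟦X⟧) (b : ℕ) :
    halfShuffle f g 0 (b + 1) =
      integ (f * (integ ^ (b + 2)) g) + integ (halfShuffle f g 0 b) := by
  unfold halfShuffle
  rw [Finset.sum_range_succ', add_comm, map_sum]
  congr 1
  · simp
  · apply Finset.sum_congr (by simp)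
    intro i _
    rw [map_smul, ← integ_pow_succ]
    rw [Nat.choose_zero_right, Nat.choose_zero_right]
    congr 5
    omega

lemma halfShuffle_zero_right (f g : ℝ⟦X⟧) (a : ℕ) :
    halfShuffle f g (a + 1) 0 = integ (halfShuffle f g a 0) := by
  unfold halfShuffle
  rw [Finset.sum_range_succ', map_sum]
  simp only [Nat.choose_zero_succ, Nat.cast_zero, zero_smul, add_zero]
  apply Finset.sum_congr rfl
  intro i hi
  have hi : i < a + 1 := Finset.mem_range.1 hi
  rw [map_smul, ← integ_pow_succ, Nat.choose_succ_succ, Nat.choose_eq_zero_of_lt hi, add_zero]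
  congr 5
  omega

lemma halfShuffle_succ_succ (f g : ℝ⟦X⟧) (a b : ℕ) :
    halfShuffle f g (a + 1) (b + 1) =
      integ (halfShuffle f g a (b + 1)) + integ (halfShuffle f g (a + 1) b) := by
  unfold halfShuffle
  have h1 : a + 1 + b + 1 = a + (b + 1) + 1 := by ring
  have h2 : a + 1 + (b + 1) + 1 = (a + (b + 1) + 1) + 1 := by ring
  rw [h1, h2, Finset.sum_range_succ', map_sum, map_sum, ← Finset.sum_add_distrib]
  simp only [Nat.choose_zero_succ, Nat.cast_zero, zero_smul, add_zero]
  apply Finset.sum_congr rfl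
  intro i hi
  have h3 : a + 1 + (b + 1) - (i + 1) = a + (b + 1) - i := by omega
  have h4 : a + 1 + b - i = a + (b + 1) - i := by omega
  rw [map_smul, map_smul, ← integ_pow_succ, ← integ_pow_succ, h3, h4, ← add_smul,
    Nat.choose_succ_succ]
  push_cast; rfl

/-- The shuffle product of two iterated integrals, split according to which of the two inner
functions comes first. -/
lemma integ_pow_mul_integ_pow {f g : ℝ⟦X⟧} (hf : PowerSeries.coeff 0 f = 0)
    (hg : PowerSeries.coeff 0 g = 0) (a b : ℕ) :
    (integ ^ (a + 1)) f * (integ ^ (b + 1)) g = halfShuffle f g a b + halfShuffle g f b a := by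
  have step (a b : ℕ) : (integ ^ (a + 1)) f * (integ ^ (b + 1)) g =
      integ ((integ ^ a) f * (integ ^ (b + 1)) g) +
        integ ((integ ^ (a + 1)) f * (integ ^ b) g) := by
    have h := integ_mul_integ (coeff_zero_integ_pow a hf) (coeff_zero_integ_pow b hg)
    simpa only [← integ_pow_succ] using h
  induction a generalizing b with
  | zero =>
    induction b with
    | zero => rw [step]; simp [halfShuffle, mul_comm g]
    | succ b ih =>
      rw [step, ih, halfShuffle_zero_left, halfShuffle_zero_right, map_add, pow_zero,
        Module.End.one_apply]
      abel
  | succ a iha =>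
    induction b with
    | zero =>
      rw [step, iha, halfShuffle_zero_left, halfShuffle_zero_right, map_add, pow_zero,
        Module.End.one_apply, mul_comm g]
      abel
    | succ b ihb =>
      rw [step, iha, ihb, halfShuffle_succ_succ, halfShuffle_succ_succ, map_add, map_add]
      abel

/-- The operator that puts a new first entry `k` in front of the index of a polylogarithm. -/
noncomputable def prepend (t : ℝ) (k : ℕ) : ℝ⟦X⟧ →ₗ[ℝ] ℝ⟦X⟧ :=
  integ ^ k * LinearMap.mulLeft ℝ (geom + PowerSeries.C t)

lemma prepend_apply (t : ℝ) (k : ℕ) (f : ℝ⟦X⟧) :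
    prepend t k f = (integ ^ k) ((geom + PowerSeries.C t) * f) := rfl

lemma prepend_polylog (t : ℝ) (k a : ℕ) (l : List ℕ) :
    prepend t k (polylog t (a :: l)) = polylog t (k :: a :: l) := by
  rw [prepend_apply, polylog_cons t k, innerSeries_cons]

lemma polylog_mul_polylog (t : ℝ) (a b : ℕ) (A B : List ℕ) :
    polylog t ((a + 1) :: A) * polylog t ((b + 1) :: B) =
      halfShuffle (innerSeries t A) (innerSeries t B) a b +
        halfShuffle (innerSeries t B) (innerSeries t A) b a := by
  simp only [polylog_cons]
  exact integ_pow_mul_integ_pow (coeff_zero_innerSeries t A) (coeff_zero_innerSeries t B) a b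

lemma halfShuffle_innerSeries_cons (t : ℝ) (a b k : ℕ) (A B : List ℕ) :
    halfShuffle (innerSeries t (k :: A)) (innerSeries t B) a b =
      ∑ α ∈ Finset.range (a + b + 1), (α.choose a : ℝ) •
        prepend t (α + 1) (polylog t (k :: A) * polylog t ((a + b - α + 1) :: B)) := by
  apply Finset.sum_congr rfl
  intro α _
  rw [innerSeries_cons, prepend_apply, mul_assoc, polylog_cons t (a + b - α + 1)]

/-- When the first word is used up, its last letter is `z / (1 - z)` rather than
`z / (1 - z) + t`; this is where the correction terms come from. -/
lemma halfShuffle_innerSeries_nil (t : ℝ) (a b : ℕ) (B : List ℕ) :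
    halfShuffle (innerSeries t []) (innerSeries t B) a b =
      ∑ α ∈ Finset.range (a + b + 1), (α.choose a : ℝ) •
        (polylog t ((α + 1) :: (a + b - α + 1) :: B) - t • polylog t ((a + b + 2) :: B)) := by
  apply Finset.sum_congr rfl
  intro α hα
  have hα : α < a + b + 1 := Finset.mem_range.1 hα
  have h : a + b + 2 = (α + 1) + (a + b - α + 1) := by omega
  have h' : (integ ^ (α + 1)) (polylog t ((a + b - α + 1) :: B)) =
      polylog t ((a + b + 2) :: B) := by
    rw [polylog_cons, polylog_cons, h, ← Module.End.mul_apply, ← pow_add]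
  rw [polylog_cons t (α + 1), innerSeries_cons, ← h', innerSeries_nil, add_mul, map_add,
    ← PowerSeries.smul_eq_C_mul, map_smul, add_sub_cancel_right, ← polylog_cons]

/-! ### Multiple zeta values as sums of polylogarithm coefficients -/

open Classical in
/-- The multiple harmonic sum `∑ 1 / (m₁ ^ l₁ ⋯ mᵣ ^ lᵣ)` over `N > m₁ > ⋯ > mᵣ ≥ 1`, with values in
`[0, ∞]`; for `N = ⊤` the upper bound is absent. -/
noncomputable def harmonicSum (l : List ℕ) (N : ℕ∞) : ENNReal :=
  ∑' m : Fin l.length → ℕ, if StrictAnti m ∧ (∀ i, 1 ≤ m i) ∧ (∀ i, (m i : ℕ∞) < N) then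
    ∏ i, ENNReal.ofReal (1 / (m i : ℝ) ^ l.get i) else 0

lemma harmonicSum_nil (N : ℕ∞) : harmonicSum [] N = 1 := by
  unfold harmonicSum
  rw [tsum_eq_single (fun i => i.elim0)]
  · rw [if_pos]
    · simp
    · exact ⟨fun i => i.elim0, fun i => i.elim0, fun i => i.elim0⟩
  · intro m hm
    exact absurd (funext fun i => i.elim0) hm

lemma strictAnti_cons {r : ℕ} (a : ℕ) (m : Fin r → ℕ) :
    StrictAnti (Fin.cons a m : Fin (r + 1) → ℕ) ↔ StrictAnti m ∧ ∀ i, m i < a := by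
  constructor
  · intro h
    refine ⟨fun i j hij => ?_, fun i => ?_⟩
    · simpa using h (Fin.succ_lt_succ_iff.2 hij)
    · simpa using h (Fin.succ_pos i)
  · rintro ⟨h1, h2⟩ i j hij
    induction j using Fin.cases with
    | zero => exact absurd hij (Fin.not_lt_zero i)
    | succ j =>
      induction i using Fin.cases with
      | zero => simpa using h2 j
      | succ i => simpa using h1 (Fin.succ_lt_succ_iff.1 hij)

lemma harmonicSum_cons (k : ℕ) (l : List ℕ) (N : ℕ∞) :
    harmonicSum (k :: l) N = ∑' a : ℕ, if 1 ≤ a ∧ (a : ℕ∞) < N then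
      ENNReal.ofReal (1 / (a : ℝ) ^ k) * harmonicSum l a else 0 := by
  classical
  have h1 : harmonicSum (k :: l) N = ∑' m : Fin (l.length + 1) → ℕ,
      if StrictAnti m ∧ (∀ i, 1 ≤ m i) ∧ (∀ i, (m i : ℕ∞) < N) then
        ∏ i : Fin (l.length + 1), ENNReal.ofReal (1 / (m i : ℝ) ^ (k :: l).get i) else 0 := rfl
  rw [h1, ← (Fin.consEquiv fun _ : Fin (l.length + 1) => ℕ).tsum_eq, ENNReal.tsum_prod']
  congr 1
  ext a
  by_cases ha : 1 ≤ a ∧ (a : ℕ∞) < N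
  · rw [if_pos ha, harmonicSum, ← ENNReal.tsum_mul_left]
    congr 1
    ext m
    change (if StrictAnti (Fin.cons a m : Fin (l.length + 1) → ℕ) ∧ _ then _ else _) = _
    simp only [Fin.consEquiv_apply, mul_ite, mul_zero, Fin.prod_univ_succ, Fin.cons_zero,
      Fin.cons_succ]
    refine if_congr ?_ rfl rfl
    rw [strictAnti_cons]
    simp only [Fin.forall_fin_succ, Fin.cons_zero, Fin.cons_succ, Nat.cast_lt]
    constructor
    · rintro ⟨⟨h1, h2⟩, ⟨-, h3⟩, -⟩
      exact ⟨h1, h3, h2⟩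
    · rintro ⟨h1, h3, h2⟩
      exact ⟨⟨h1, h2⟩, ⟨ha.1, h3⟩, ha.2, fun i => lt_trans (by exact_mod_cast h2 i) ha.2⟩
  · rw [if_neg ha]
    apply ENNReal.tsum_eq_zero.2
    intro m
    rw [if_neg]
    rintro ⟨-, h1, h2⟩
    exact ha ⟨by simpa using h1 0, by simpa using h2 0⟩

lemma mzv_eq_toReal (l : List ℕ) : mzv l = (harmonicSum l ⊤).toReal := by
  classical
  have h : harmonicSum l ⊤ =
      ∑' m : {m : Fin l.length → ℕ // StrictAnti m ∧ ∀ i, 1 ≤ m i},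
        ENNReal.ofReal (∏ i : Fin l.length, 1 / ((m.1 i : ℝ) ^ l.get i)) := by
    have h2 := tsum_subtype {m : Fin l.length → ℕ | StrictAnti m ∧ ∀ i, 1 ≤ m i}
      fun m => ENNReal.ofReal (∏ i : Fin l.length, 1 / ((m i : ℝ) ^ l.get i))
    refine Eq.trans ?_ h2.symm
    unfold harmonicSum
    congr 1
    ext m
    rw [Set.indicator_apply]
    refine if_congr (by simp) ?_ rfl
    rw [ENNReal.ofReal_prod_of_nonneg]
    intro i _
    positivity
  rw [h, ENNReal.tsum_toReal_eq fun _ => ENNReal.ofReal_ne_top]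
  unfold mzv
  congr 1
  ext m
  rw [ENNReal.toReal_ofReal]
  positivity

lemma coeff_geom_mul (f : ℝ⟦X⟧) (n : ℕ) :
    PowerSeries.coeff n (geom * f) = ∑ j ∈ Finset.range n, PowerSeries.coeff j f := by
  rw [mul_comm, PowerSeries.coeff_mul, Finset.Nat.sum_antidiagonal_eq_sum_range_succ_mk,
    Finset.sum_range_succ]
  simp only [geom, PowerSeries.coeff_mk, Nat.sub_self, if_true, mul_zero, add_zero]
  apply Finset.sum_congr rfl
  intro j hj
  rw [if_neg (by have := Finset.mem_range.1 hj; omega), mul_one]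

lemma coeff_innerSeries_zero_cons (k : ℕ) (l : List ℕ) (n : ℕ) :
    PowerSeries.coeff n (innerSeries 0 (k :: l)) =
      ∑ j ∈ Finset.range n, PowerSeries.coeff j (innerSeries 0 l) / (j : ℝ) ^ k := by
  rw [innerSeries_cons, map_zero, add_zero, coeff_geom_mul]
  simp only [polylog_cons, coeff_integ_pow]

lemma coeff_innerSeries_zero_nonneg (l : List ℕ) (n : ℕ) :
    0 ≤ PowerSeries.coeff n (innerSeries 0 l) := by
  induction l generalizing n with
  | nil => rw [innerSeries_nil, geom, PowerSeries.coeff_mk]; positivity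
  | cons k l ih =>
    rw [coeff_innerSeries_zero_cons]
    exact Finset.sum_nonneg fun j _ => div_nonneg (ih j) (by positivity)

lemma coeff_polylog_zero_nonneg (k : ℕ) (l : List ℕ) (n : ℕ) :
    0 ≤ PowerSeries.coeff n (polylog 0 (k :: l)) := by
  rw [polylog_cons, coeff_integ_pow]
  exact div_nonneg (coeff_innerSeries_zero_nonneg l n) (by positivity)

lemma ofReal_coeff_innerSeries_zero (l : List ℕ) (n : ℕ) (hn : 1 ≤ n) :
    ENNReal.ofReal (PowerSeries.coeff n (innerSeries 0 l)) = harmonicSum l n := by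
  induction l generalizing n with
  | nil =>
    rw [harmonicSum_nil, innerSeries_nil, geom, PowerSeries.coeff_mk, if_neg (by omega)]
    simp
  | cons k l ih =>
    rw [coeff_innerSeries_zero_cons, harmonicSum_cons, ENNReal.ofReal_sum_of_nonneg
      fun j _ => div_nonneg (coeff_innerSeries_zero_nonneg l j) (by positivity),
      tsum_eq_sum (s := Finset.range n)]
    · apply Finset.sum_congr rfl
      intro j hj
      have hj : j < n := Finset.mem_range.1 hj
      rcases Nat.eq_zero_or_pos j with rfl | hj0
      · rw [coeff_zero_innerSeries]; simp
      · rw [if_pos ⟨hj0, by exact_mod_cast hj⟩, ← ih j hj0, ← ENNReal.ofReal_mul (by positivity)]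
        congr 1; ring
    · intro j hj
      rw [if_neg]
      rintro ⟨-, h⟩
      exact hj (Finset.mem_range.2 (by exact_mod_cast h))

/-- The multiple zeta value is the value of the polylogarithm at `z = 1`. Both series have
nonnegative terms and the same sum in `[0, ∞]`; if that sum is infinite, both sides are `0`. -/
lemma mzv_cons_eq_tsum (k : ℕ) (l : List ℕ) :
    mzv (k :: l) = ∑' n, PowerSeries.coeff n (polylog 0 (k :: l)) := by
  rw [mzv_eq_toReal]
  have h : harmonicSum (k :: l) ⊤ =
      ∑' n, ENNReal.ofReal (PowerSeries.coeff n (polylog 0 (k :: l))) := by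
    rw [harmonicSum_cons]
    congr 1
    ext n
    rw [polylog_cons, coeff_integ_pow]
    rcases Nat.eq_zero_or_pos n with rfl | hn
    · rw [coeff_zero_innerSeries]; simp
    · rw [if_pos ⟨hn, ENat.natCast_lt_top n⟩, ← ofReal_coeff_innerSeries_zero l n hn,
        ← ENNReal.ofReal_mul (by positivity)]
      congr 1; ring
  rw [h, ENNReal.tsum_toReal_eq fun _ => ENNReal.ofReal_ne_top]
  congr 1
  ext n
  exact ENNReal.toReal_ofReal (coeff_polylog_zero_nonneg k l n)

/-! ### Convergence -/

lemma sum_one_div_sqrt_le (n : ℕ) : ∑ j ∈ Finset.range n, 1 / √(j : ℝ) ≤ 2 * √(n : ℝ) := by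
  have h (n : ℕ) : ∑ j ∈ Finset.range (n + 1), 1 / √(j : ℝ) ≤ 2 * √(n : ℝ) := by
    induction n with
    | zero => simp
    | succ n ih =>
      rw [Finset.sum_range_succ]
      have hx : √((n + 1 : ℕ) : ℝ) ^ 2 = n + 1 := by rw [Real.sq_sqrt (by positivity)]; simp
      have hy : √(n : ℝ) ^ 2 = n := Real.sq_sqrt (by positivity)
      have hx0 : 0 < √((n + 1 : ℕ) : ℝ) := Real.sqrt_pos.2 (by positivity)
      have h : 1 / √((n + 1 : ℕ) : ℝ) ≤ 2 * √((n + 1 : ℕ) : ℝ) - 2 * √(n : ℝ) := by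
        rw [div_le_iff₀ hx0]
        nlinarith [sq_nonneg (√((n + 1 : ℕ) : ℝ) - √(n : ℝ))]
      linarith
  refine le_trans ?_ (h n)
  rw [Finset.sum_range_succ]
  exact le_add_of_nonneg_right (by positivity)

/-- Multiple harmonic sums grow more slowly than a power: the bound `√n`, up to a constant, is
reproduced by every summation. -/
lemma coeff_innerSeries_zero_le (l : List ℕ) (hl : ∀ k ∈ l, 1 ≤ k) :
    ∃ c : ℝ, 0 ≤ c ∧ ∀ n : ℕ, PowerSeries.coeff n (innerSeries 0 l) ≤ c * √(n : ℝ) := by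
  induction l with
  | nil =>
    refine ⟨1, zero_le_one, fun n => ?_⟩
    rw [innerSeries_nil, geom, PowerSeries.coeff_mk, one_mul]
    split_ifs with h
    · positivity
    · exact Real.one_le_sqrt.2 (by exact_mod_cast Nat.one_le_iff_ne_zero.2 h)
  | cons k l ih =>
    obtain ⟨c, hc, h⟩ := ih fun j hj => hl j (List.mem_cons_of_mem _ hj)
    have hk : 1 ≤ k := hl k List.mem_cons_self
    refine ⟨c * 2, by positivity, fun n => ?_⟩
    rw [coeff_innerSeries_zero_cons, mul_assoc]
    refine le_trans ?_ (mul_le_mul_of_nonneg_left (sum_one_div_sqrt_le n) hc)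
    rw [Finset.mul_sum]
    apply Finset.sum_le_sum
    intro j _
    rcases Nat.eq_zero_or_pos j with rfl | hj
    · rw [coeff_zero_innerSeries]; simp
    · have hj1 : (1 : ℝ) ≤ j := by exact_mod_cast hj
      have h2 : (j : ℝ) ≤ (j : ℝ) ^ k := le_self_pow₀ hj1 (by omega)
      calc PowerSeries.coeff j (innerSeries 0 l) / (j : ℝ) ^ k
          ≤ c * √(j : ℝ) / j := div_le_div₀ (by positivity) (h j) (by positivity) h2
        _ = c * (1 / √(j : ℝ)) := by
          rw [mul_div_assoc, Real.sqrt_div_self']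

/-- An index is admissible if its multiple zeta value converges for the usual reason: the entries
are positive and the first one is at least `2`. -/
def Admissible : List ℕ → Prop
  | [] => False
  | k :: l => 2 ≤ k ∧ ∀ j ∈ l, 1 ≤ j

lemma summable_coeff_polylog_zero {l : List ℕ} (hl : Admissible l) :
    Summable fun n => PowerSeries.coeff n (polylog 0 l) := by
  cases l with
  | nil => exact hl.elim
  | cons k l =>
    obtain ⟨hk, hl⟩ := hl
    obtain ⟨c, hc, h⟩ := coeff_innerSeries_zero_le l hl
    have hs : Summable fun n : ℕ => c * (1 / (n : ℝ) ^ (3 / 2 : ℝ)) :=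
      (Real.summable_one_div_nat_rpow.2 (by norm_num)).mul_left c
    refine hs.of_nonneg_of_le (coeff_polylog_zero_nonneg k l) fun n => ?_
    rw [polylog_cons, coeff_integ_pow]
    rcases Nat.eq_zero_or_pos n with rfl | hn
    · rw [coeff_zero_innerSeries, zero_div]; positivity
    · have hn1 : (1 : ℝ) ≤ n := by exact_mod_cast hn
      have hn0 : (0 : ℝ) < n := by linarith
      have h2 : (n : ℝ) ^ 2 ≤ (n : ℝ) ^ k := pow_le_pow_right₀ hn1 hk
      refine (div_le_div₀ (by positivity) (h n) (by positivity) h2).trans (le_of_eq ?_)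
      rw [mul_div_assoc, Real.sqrt_eq_rpow, ← Real.rpow_natCast, ← Real.rpow_sub hn0, one_div,
        one_div, ← Real.rpow_neg hn0.le]
      norm_num

lemma hasSum_coeff_polylog_zero {l : List ℕ} (hl : Admissible l) :
    HasSum (fun n => PowerSeries.coeff n (polylog 0 l)) (mzv l) := by
  have h := summable_coeff_polylog_zero hl
  cases l with
  | nil => exact hl.elim
  | cons k l => rw [mzv_cons_eq_tsum]; exact h.hasSum

/-! ### The interpolated values -/

lemma length_le_of_mem_boxFillingsCons (l : List ℕ) (a : ℕ) (w : List ℕ)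
    (hw : w ∈ boxFillingsCons a l) : w.length ≤ l.length + 1 := by
  induction l generalizing a w with
  | nil => simp only [boxFillingsCons, List.mem_singleton] at hw; simp [hw]
  | cons b l ih =>
    simp only [boxFillingsCons, List.mem_append, List.mem_map] at hw
    rcases hw with ⟨w', hw', rfl⟩ | hw
    · simpa using ih b w' hw'
    · exact (ih _ w hw).trans (by simp)

lemma ne_nil_of_mem_boxFillingsCons (l : List ℕ) (a : ℕ) (w : List ℕ)
    (hw : w ∈ boxFillingsCons a l) : ∃ b w', w = b :: w' := by
  induction l generalizing a w with
  | nil => simp only [boxFillingsCons, List.mem_singleton] at hw; simp [hw]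
  | cons b l ih =>
    simp only [boxFillingsCons, List.mem_append, List.mem_map] at hw
    rcases hw with ⟨w', hw', rfl⟩ | hw
    · exact ⟨_, _, rfl⟩
    · exact ih _ w hw

lemma pos_of_mem_boxFillingsCons (l : List ℕ) (a : ℕ) (w : List ℕ) (ha : 1 ≤ a)
    (hl : ∀ j ∈ l, 1 ≤ j) (hw : w ∈ boxFillingsCons a l) : ∀ j ∈ w, 1 ≤ j := by
  induction l generalizing a w with
  | nil => simp only [boxFillingsCons, List.mem_singleton] at hw; simp [hw, ha]
  | cons b l ih =>
    simp only [boxFillingsCons, List.mem_append, List.mem_map] at hw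
    simp only [List.mem_cons, forall_eq_or_imp] at hl
    rcases hw with ⟨w', hw', rfl⟩ | hw
    · simp only [List.mem_cons, forall_eq_or_imp]
      exact ⟨ha, ih b w' hl.1 hl.2 hw'⟩
    · exact ih _ w (by omega) hl.2 hw

lemma admissible_of_mem_boxFillingsCons (l : List ℕ) (a : ℕ) (w : List ℕ) (ha : 2 ≤ a)
    (hl : ∀ j ∈ l, 1 ≤ j) (hw : w ∈ boxFillingsCons a l) : Admissible w := by
  induction l generalizing a w with
  | nil => simp only [boxFillingsCons, List.mem_singleton] at hw; simp [hw, ha, Admissible]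
  | cons b l ih =>
    simp only [boxFillingsCons, List.mem_append, List.mem_map] at hw
    simp only [List.mem_cons, forall_eq_or_imp] at hl
    rcases hw with ⟨w', hw', rfl⟩ | hw
    · exact ⟨ha, pos_of_mem_boxFillingsCons l b w' hl.1 hl.2 hw'⟩
    · exact ih _ w (by omega) hl.2 hw

/-- The interpolated polylogarithm is the combination of ordinary ones by which `imzv` is
defined. -/
lemma polylog_eq_sum_boxFillingsCons (t : ℝ) (a : ℕ) (l : List ℕ) :
    polylog t (a :: l) =
      ((boxFillingsCons a l).map fun w => t ^ (l.length + 1 - w.length) • polylog 0 w).sum := by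
  induction l generalizing a with
  | nil => simp [boxFillingsCons, polylog_cons, innerSeries_nil]
  | cons b l ih =>
    have h1 : polylog t (a :: b :: l) =
        (integ ^ a) (geom * polylog t (b :: l)) + t • polylog t ((a + b) :: l) := by
      rw [polylog_cons, innerSeries_cons, add_mul, map_add, ← PowerSeries.smul_eq_C_mul, map_smul,
        polylog_cons t b, polylog_cons t (a + b), pow_add, Module.End.mul_apply]
    rw [h1, boxFillingsCons, List.map_append, List.sum_append, List.map_map]
    congr 1
    · let T : ℝ⟦X⟧ →ₗ[ℝ] ℝ⟦X⟧ := integ ^ a * LinearMap.mulLeft ℝ geom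
      change T (polylog t (b :: l)) = _
      rw [ih b, map_list_sum, List.map_map]
      congr 1
      apply List.map_congr_left
      intro w hw
      obtain ⟨c, w, rfl⟩ := ne_nil_of_mem_boxFillingsCons l b w hw
      simp only [Function.comp_apply, map_smul, List.length_cons, Nat.add_sub_add_right]
      rw [polylog_cons 0 a, innerSeries_cons, map_zero, add_zero]
      rfl
    · rw [ih (a + b), List.smul_sum, List.map_map]
      congr 1
      apply List.map_congr_left
      intro w hw
      have := length_le_of_mem_boxFillingsCons l (a + b) w hw
      rw [Function.comp_apply, smul_smul, ← pow_succ', List.length_cons]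
      congr 2
      omega

/-- The interpolated multiple zeta value is the sum of the coefficients of the interpolated
polylogarithm, which converges absolutely. -/
lemma hasSum_coeff_polylog (t : ℝ) {l : List ℕ} (hl : Admissible l) :
    HasSum (fun n => PowerSeries.coeff n (polylog t l)) ((imzv l).eval t) := by
  cases l with
  | nil => exact hl.elim
  | cons a l =>
    rw [polylog_eq_sum_boxFillingsCons, imzv, boxFillings]
    have h := fun w hw => admissible_of_mem_boxFillingsCons l a w hl.1 hl.2 hw
    generalize boxFillingsCons a l = L at h
    induction L with
    | nil => simp
    | cons w L ih =>
      simp only [List.map_cons, List.sum_cons, map_add, Polynomial.eval_add]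
      refine HasSum.add ?_ (ih fun w' hw' => h w' (List.mem_cons_of_mem _ hw'))
      have hw := h w List.mem_cons_self
      simp only [map_smul, smul_eq_mul, Polynomial.eval_mul, Polynomial.eval_pow,
        Polynomial.eval_X, Polynomial.eval_C, List.length_cons]
      exact (hasSum_coeff_polylog_zero hw).mul_left _

/-- Cauchy products: evaluation of power series at `1` is multiplicative where it converges
absolutely. -/
lemma hasSum_coeff_mul {f g : ℝ⟦X⟧} {x y : ℝ} (hf : HasSum (fun n => PowerSeries.coeff n f) x)
    (hg : HasSum (fun n => PowerSeries.coeff n g) y) :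
    HasSum (fun n => PowerSeries.coeff n (f * g)) (x * y) := by
  rw [← hf.tsum_eq, ← hg.tsum_eq,
    tsum_mul_tsum_eq_tsum_sum_antidiagonal_of_summable_norm hf.summable.norm hg.summable.norm]
  simp only [PowerSeries.coeff_mul]
  exact (summable_norm_sum_mul_antidiagonal_of_summable_norm hf.summable.norm
    hg.summable.norm).of_norm.hasSum

/-! ### Peeling off the first entry of an index -/

/-- The sequence `(a, α₁, α₂, …)`, indexed from `1`. -/
def consSeq (a : ℕ) (α : ℕ → ℕ) : ℕ → ℕ
  | 0 => 0
  | 1 => a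
  | i + 2 => α (i + 1)

lemma consSeq_one (a : ℕ) (α : ℕ → ℕ) : consSeq a α 1 = a := rfl

lemma consSeq_succ (a : ℕ) (α : ℕ → ℕ) {i : ℕ} (hi : 1 ≤ i) : consSeq a α (i + 1) = α i := by
  obtain ⟨i, rfl⟩ := Nat.exists_eq_add_of_le' hi
  rfl

@[to_additive]
lemma prod_Icc_shift {M : Type*} [CommMonoid M] (a b : ℕ) (f : ℕ → M) :
    ∏ i ∈ Finset.Icc (a + 1) (b + 1), f i = ∏ i ∈ Finset.Icc a b, f (i + 1) := by
  rw [← Finset.map_add_right_Icc, Finset.prod_map]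
  rfl

@[to_additive]
lemma prod_Icc_succ_first {M : Type*} [CommMonoid M] (b : ℕ) (f : ℕ → M) :
    ∏ i ∈ Finset.Icc 1 (b + 1), f i = f 1 * ∏ i ∈ Finset.Icc 1 b, f (i + 1) := by
  rw [← prod_Icc_shift, ← Finset.insert_Icc_add_one_left_eq_Icc (by omega : 1 ≤ b + 1),
    Finset.prod_insert (by simp)]

lemma sum_piAntidiag_succ {M : Type*} [AddCommMonoid M] (K s : ℕ) (F : (ℕ → ℕ) → M) :
    ∑ α ∈ Finset.piAntidiag (Finset.Icc 1 (K + 1)) s, F α =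
      ∑ a ∈ Finset.range (s + 1), ∑ α ∈ Finset.piAntidiag (Finset.Icc 1 K) (s - a),
        F (consSeq a α) := by
  rw [Finset.sum_sigma']
  symm
  refine Finset.sum_bij' (fun x _ => consSeq x.1 x.2)
    (fun α _ => ⟨α 1, fun i => if i = 0 then 0 else α (i + 1)⟩) ?_ ?_ ?_ ?_ ?_
  · rintro ⟨a, α⟩ hx
    simp only [Finset.mem_sigma, Finset.mem_range, Finset.mem_piAntidiag] at hx ⊢
    obtain ⟨h1, h2, h3⟩ := hx
    refine ⟨?_, fun i hi => ?_⟩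
    · rw [sum_Icc_succ_first, consSeq_one, Finset.sum_congr rfl fun i hi =>
        consSeq_succ a α (Finset.mem_Icc.1 hi).1, h2]
      omega
    · rw [Finset.mem_Icc]
      match i, hi with
      | 0, hi => exact absurd rfl hi
      | 1, hi => omega
      | i + 2, hi =>
        have := Finset.mem_Icc.1 (h3 (i + 1) hi)
        omega
  · intro α hα
    simp only [Finset.mem_sigma, Finset.mem_range, Finset.mem_piAntidiag] at hα ⊢
    obtain ⟨h1, h2⟩ := hα
    rw [sum_Icc_succ_first] at h1
    refine ⟨by omega, ?_, fun i hi => ?_⟩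
    · rw [← h1, Nat.add_sub_cancel_left]
      exact Finset.sum_congr rfl fun i hi => if_neg (by have := Finset.mem_Icc.1 hi; omega)
    · have hi0 : i ≠ 0 := by rintro rfl; simp at hi
      rw [if_neg hi0] at hi
      have := Finset.mem_Icc.1 (h2 _ hi)
      rw [Finset.mem_Icc]; omega
  · rintro ⟨a, α⟩ hx
    simp only [Finset.mem_sigma, Finset.mem_range, Finset.mem_piAntidiag] at hx
    obtain ⟨h1, h2, h3⟩ := hx
    have e2 : (fun i => if i = 0 then 0 else consSeq a α (i + 1)) = α := by
      funext i
      rcases Nat.eq_zero_or_pos i with rfl | hi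
      · by_contra h
        have := Finset.mem_Icc.1 (h3 0 fun h0 => h (by simp [h0]))
        omega
      · rw [if_neg (by omega), consSeq_succ a α hi]
    simp only [e2, consSeq_one]
  · intro α hα
    rw [Finset.mem_piAntidiag] at hα
    funext i
    match i with
    | 0 =>
      by_contra h
      have := Finset.mem_Icc.1 (hα.2 0 fun h0 => h (by simp [h0, consSeq]))
      omega
    | 1 => rfl
    | i + 2 => simp [consSeq]
  · intro _ _; rfl

lemma shifted_eq_cons (α : ℕ → ℕ) {a b : ℕ} (h : a ≤ b) :
    shifted α a b = (α a + 1) :: shifted α (a + 1) b := by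
  rw [shifted, shifted, List.Ico.eq_cons (by omega), List.map_cons]

lemma shifted_consSeq (c : ℕ) (α : ℕ → ℕ) {a : ℕ} (b : ℕ) (ha : 1 ≤ a) :
    shifted (consSeq c α) (a + 1) (b + 1) = shifted α a b := by
  rw [shifted, shifted, ← List.Ico.map_add, List.map_map]
  apply List.map_congr_left
  intro i hi
  have := (List.Ico.mem.1 hi).1
  simp only [Function.comp_apply]
  rw [add_comm 1 i, consSeq_succ c α (by omega)]

lemma shifted_consSeq_one (c : ℕ) (α : ℕ → ℕ) (b : ℕ) :
    shifted (consSeq c α) 1 (b + 1) = (c + 1) :: shifted α 1 b := by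
  rw [shifted_eq_cons _ (by omega), consSeq_one, shifted_consSeq c α b le_rfl]

lemma merged_consSeq (c : ℕ) (α : ℕ → ℕ) (K : ℕ) {k : ℕ} (hk : 1 ≤ k) :
    merged (consSeq c α) (K + 1) (k + 1) = (c + 1) :: merged α K k := by
  obtain ⟨k, rfl⟩ := Nat.exists_eq_add_of_le' hk
  rw [merged, merged, Nat.add_sub_cancel, shifted_consSeq_one, consSeq_succ c α (by omega),
    consSeq_succ c α (by omega), shifted_consSeq c α K (by omega), Nat.add_sub_cancel]
  rfl

lemma coeff_consSeq (K M p a : ℕ) (b : ℕ → ℤ) (α : ℕ → ℕ) :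
    coeff (K + 1) (M + 1) p b (consSeq a α) =
      binom a (b 1) * coeff K M p (fun i => b (i + 1)) α := by
  rw [coeff, coeff, prod_Icc_succ_first, consSeq_one, mul_assoc,
    show M + 1 + 2 = (M + 2) + 1 by ring, prod_Icc_shift]
  congr 2
  · refine Finset.prod_congr rfl fun i hi => ?_
    rw [consSeq_succ a α (Finset.mem_Icc.1 hi).1]
  · refine Finset.prod_congr rfl fun i hi => ?_
    rw [consSeq_succ a α (by have := (Finset.mem_Icc.1 hi).1; omega)]

lemma coeff_congr {K M p : ℕ} {b b' : ℕ → ℤ} {α : ℕ → ℕ}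
    (h : ∀ i, 1 ≤ i → i ≤ M → b i = b' i) : coeff K M p b α = coeff K M p b' α := by
  rw [coeff, coeff]
  congr 1
  refine Finset.prod_congr rfl fun i hi => ?_
  rw [Finset.mem_Icc] at hi
  rw [h i hi.1 hi.2]

open Classical in
/-- The lower entries of the binomial coefficients for an arbitrary set `S` of block starts, an
arbitrary first entry `h`, and an arbitrary total `tot`. Here `h` and `tot - h` are the numbers of
letters `x` in front of the first letter `y` in the word that comes first and in the other word. In
this generality the entries are stable under removing the first letter `y` of the shuffle. -/
noncomputable def entry (S : ℕ → Prop) (h tot : ℤ) (p : ℕ) (α : ℕ → ℕ) (i : ℕ) : ℤ :=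
  if i = 1 then h
  else if S i then ((i : ℤ) - 2) * ((p : ℤ) - 1) + tot - ∑ k ∈ Finset.Icc 1 (i - 1), (α k : ℤ)
  else (p : ℤ) - 1

open Classical in
lemma entry_consSeq (S : ℕ → Prop) (h tot : ℤ) (p a : ℕ) (α : ℕ → ℕ) {i : ℕ} (hi : 1 ≤ i) :
    entry S h tot p (consSeq a α) (i + 1) =
      entry (fun j => S (j + 1)) (if S 2 then tot - a else p - 1) (tot - a + (p - 1)) p α i := by
  obtain ⟨i, rfl⟩ := Nat.exists_eq_add_of_le' hi
  have hs : ∑ k ∈ Finset.Icc 1 (i + 1), (consSeq a α k : ℤ) =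
      a + ∑ k ∈ Finset.Icc 1 i, (α k : ℤ) := by
    rw [sum_Icc_succ_first, consSeq_one]
    congr 1
    exact Finset.sum_congr rfl fun k hk => by rw [consSeq_succ a α (Finset.mem_Icc.1 hk).1]
  unfold entry
  rw [if_neg (by omega : i + 1 + 1 ≠ 1), Nat.add_sub_cancel, Nat.add_sub_cancel, hs]
  rcases Nat.eq_zero_or_pos i with rfl | hi
  · simp
  · rw [if_neg (by omega : i + 1 ≠ 1)]
    refine if_congr Iff.rfl ?_ rfl
    push_cast; ring

/-- The sum, over all `α`, of the terms that belong to one interleaving of the two words: `S` is the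
set of block starts, `K` the number of letters `y`, and `M` the position where one of the words is
used up. -/
noncomputable def interleavingSum (t : ℝ) (p : ℕ) (S : ℕ → Prop) (K M : ℕ) (h tot : ℤ) (s : ℕ) :
    ℝ⟦X⟧ :=
  ∑ α ∈ Finset.piAntidiag (Finset.Icc 1 K) s, (coeff K M p (entry S h tot p α) α : ℝ) •
    (polylog t (shifted α 1 K) - t • polylog t (merged α K M))

lemma interleavingSum_congr (t : ℝ) (p : ℕ) {S S' : ℕ → Prop} (K M : ℕ) (h tot : ℤ) (s : ℕ)
    (hS : ∀ i, 2 ≤ i → (S i ↔ S' i)) :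
    interleavingSum t p S K M h tot s = interleavingSum t p S' K M h tot s := by
  refine Finset.sum_congr rfl fun α _ => ?_
  congr 2
  refine coeff_congr fun i hi _ => ?_
  unfold entry
  split_ifs with h1 h2 h3 h3
  · rfl
  · rfl
  · exact absurd ((hS i (by omega)).1 h2) h3
  · exact absurd ((hS i (by omega)).2 h3) h2
  · rfl

lemma prepend_polylog_of_ne_nil (t : ℝ) (k : ℕ) {l : List ℕ} (hl : l ≠ []) :
    prepend t k (polylog t l) = polylog t (k :: l) := by
  cases l with
  | nil => exact absurd rfl hl
  | cons a l => exact prepend_polylog t k a l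

open Classical in
lemma interleavingSum_succ (t : ℝ) (p : ℕ) (S : ℕ → Prop) {K M : ℕ} (h tot : ℤ) (s : ℕ)
    (hM : 1 ≤ M) (hK : 1 ≤ K) :
    interleavingSum t p S (K + 1) (M + 1) h tot s =
      ∑ a ∈ Finset.range (s + 1), (binom a h : ℝ) • prepend t (a + 1)
        (interleavingSum t p (fun j => S (j + 1)) K M (if S 2 then tot - a else p - 1)
          (tot - a + (p - 1)) (s - a)) := by
  rw [interleavingSum, sum_piAntidiag_succ]
  refine Finset.sum_congr rfl fun a _ => ?_
  rw [interleavingSum, map_sum, Finset.smul_sum]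
  refine Finset.sum_congr rfl fun α _ => ?_
  rw [map_smul, map_sub, map_smul, prepend_polylog_of_ne_nil, prepend_polylog_of_ne_nil,
    smul_smul, shifted_consSeq_one, merged_consSeq _ _ _ hM, coeff_consSeq, Nat.cast_mul]
  · congr 3
    exact coeff_congr fun i hi _ => entry_consSeq S h tot p a α hi
  · simp [merged]
  · rw [shifted_eq_cons α hK]; simp

lemma binom_of_neg (a : ℕ) {b : ℤ} (hb : b < 0) : binom a b = 0 := if_neg (by omega)

lemma binom_natCast (a b : ℕ) : binom a (b : ℤ) = a.choose b := by simp [binom]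

lemma binom_of_lt {a : ℕ} {b : ℤ} (hb : (a : ℤ) < b) : binom a b = 0 := by
  rw [binom, if_pos (by omega), Nat.choose_eq_zero_of_lt (by omega)]

open Classical in
/-- The products of Kronecker deltas leave a single sequence in the sum. -/
lemma sum_piAntidiag_prod_tail {M : Type*} [AddCommMonoid M] [Module ℝ M] (N q s : ℕ)
    (F : List ℕ → M) :
    ∑ α ∈ Finset.piAntidiag (Finset.Icc 1 (N + 1)) s,
        ((∏ j ∈ Finset.Icc 2 (N + 1), if α j = q then 1 else 0 : ℕ) : ℝ) •
          F (shifted α 1 (N + 1)) =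
      if N * q ≤ s then F ((s - N * q + 1) :: List.replicate N (q + 1)) else 0 := by
  have key (α : ℕ → ℕ) : (∏ j ∈ Finset.Icc 2 (N + 1), if α j = q then 1 else 0 : ℕ) =
      if ∀ j ∈ Finset.Icc 2 (N + 1), α j = q then 1 else 0 := by
    split_ifs with h
    · exact Finset.prod_eq_one fun j hj => if_pos (h j hj)
    · push Not at h
      obtain ⟨j, hj, hne⟩ := h
      exact Finset.prod_eq_zero hj (if_neg hne)
  have total (α : ℕ → ℕ) (h : ∀ j ∈ Finset.Icc 2 (N + 1), α j = q) :
      ∑ j ∈ Finset.Icc 1 (N + 1), α j = α 1 + N * q := by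
    rw [sum_Icc_succ_first, ← sum_Icc_shift, Finset.sum_congr rfl h]
    simp
  simp only [key]
  split_ifs with hs
  · set α₀ : ℕ → ℕ := fun j => if j = 1 then s - N * q else
      if j ∈ Finset.Icc 2 (N + 1) then q else 0 with hα₀
    have h0 : ∀ j ∈ Finset.Icc 2 (N + 1), α₀ j = q := fun j hj => by
      have := (Finset.mem_Icc.1 hj).1
      simp only [hα₀]
      rw [if_neg (by omega), if_pos hj]
    rw [Finset.sum_eq_single α₀]
    · rw [if_pos h0, Nat.cast_one, one_smul, shifted_eq_cons _ (by omega)]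
      congr 2
      rw [shifted, List.eq_replicate_iff]
      refine ⟨by simp, fun b hb => ?_⟩
      simp only [List.mem_map, List.Ico.mem] at hb
      obtain ⟨j, hj, rfl⟩ := hb
      rw [h0 j (Finset.mem_Icc.2 (by omega))]
    · intro α hα hne
      rw [if_neg, Nat.cast_zero, zero_smul]
      intro h
      apply hne
      rw [Finset.mem_piAntidiag] at hα
      have h1 : α 1 + N * q = s := (total α h).symm.trans hα.1
      funext j
      simp only [hα₀]
      split_ifs with hj hj'
      · rw [hj]; omega
      · exact h j hj'
      · by_contra hj0
        have := hα.2 j hj0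
        rw [Finset.mem_Icc] at this hj'
        omega
    · intro hα
      refine absurd (Finset.mem_piAntidiag.2 ⟨?_, fun i hi => ?_⟩) hα
      · rw [total α₀ h0]
        simp only [hα₀, if_true]
        omega
      · simp only [hα₀] at hi
        rw [Finset.mem_Icc]
        split_ifs at hi with h1 h2
        · omega
        · rw [Finset.mem_Icc] at h2; omega
        · exact absurd rfl hi
  · refine Finset.sum_eq_zero fun α hα => ?_
    rw [if_neg, Nat.cast_zero, zero_smul]
    intro h
    have h1 : α 1 + N * q = s := (total α h).symm.trans (Finset.mem_piAntidiag.1 hα).1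
    omega

/-- The last step of the peeling: once a word is used up, the rest of the index is determined. -/
lemma interleavingSum_one (t : ℝ) {p : ℕ} (hp : 1 ≤ p) (S : ℕ → Prop) (N : ℕ) (h tot : ℤ) (s : ℕ)
    (hs : (s : ℤ) = tot + N * (p - 1)) :
    interleavingSum t p S (N + 2) 1 h tot s =
      ∑ a ∈ Finset.range (s + 1), if (a : ℤ) ≤ tot then (binom a h : ℝ) •
        (polylog t ((a + 1) :: (tot.toNat - a + 1) :: List.replicate N p) -
          t • polylog t ((tot.toNat + 2) :: List.replicate N p)) else 0 := by
  obtain ⟨q, rfl⟩ := Nat.exists_eq_add_of_le' hp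
  have hs' : (s : ℤ) = tot + ((N * q : ℕ) : ℤ) := by rw [hs]; push_cast; ring
  rw [interleavingSum, sum_piAntidiag_succ]
  refine Finset.sum_congr rfl fun a ha => ?_
  have ha : a < s + 1 := Finset.mem_range.1 ha
  let F : List ℕ → ℝ⟦X⟧ := fun l => (binom a h : ℝ) • (polylog t ((a + 1) :: l) -
    t • polylog t ((a + l.headI + 1) :: l.tail))
  have step := sum_piAntidiag_prod_tail N q (s - a) F
  refine Eq.trans (Finset.sum_congr rfl fun α _ => ?_) (step.trans ?_)
  · simp only [F]
    rw [coeff_consSeq _ 0, smul_smul, shifted_consSeq_one, entry, if_pos rfl, merged, coeff,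
      consSeq_one, consSeq_succ a α le_rfl, shifted_consSeq a α _ (by omega),
      shifted_eq_cons α (by omega : 1 ≤ N + 1)]
    simp [shifted, mul_comm, add_assoc]
  · by_cases hat : (a : ℤ) ≤ tot
    · have e1 : s - a - N * q = tot.toNat - a := by omega
      have e2 : a + (tot.toNat - a + 1) + 1 = tot.toNat + 2 := by omega
      rw [if_pos (by omega), if_pos hat]
      simp only [F, List.headI_cons, List.tail_cons]
      rw [e1, e2]
    · rw [if_neg (by omega), if_neg hat]

/-! ### Interleavings described by pairs of compositions -/

/-- The position `i` starts a block when the blocks of `l` and `c` alternate, beginning with `l`. -/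
def IsStart (l c : List ℕ) (i : ℕ) : Prop :=
  ∃ j, i = (l.take j).sum + (c.take j).sum + 1 ∨ i = (l.take (j + 1)).sum + (c.take j).sum + 1

/-- A first block of size `1` is removed; the roles of the two words are exchanged. -/
lemma isStart_one_cons (l c : List ℕ) {i : ℕ} (hi : 1 ≤ i) :
    IsStart (1 :: l) c (i + 1) ↔ IsStart c l i := by
  constructor
  · rintro ⟨j, h | h⟩
    · cases j with
      | zero => simp at h; omega
      | succ j =>
        refine ⟨j, Or.inr ?_⟩
        simp only [List.take_succ_cons, List.sum_cons] at h
        omega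
    · refine ⟨j, Or.inl ?_⟩
      simp only [List.take_succ_cons, List.sum_cons] at h
      omega
  · rintro ⟨j, h | h⟩
    · refine ⟨j, Or.inr ?_⟩
      simp only [List.take_succ_cons, List.sum_cons]
      omega
    · refine ⟨j + 1, Or.inl ?_⟩
      simp only [List.take_succ_cons, List.sum_cons]
      omega

/-- The first block is shortened by one. -/
lemma isStart_succ_cons (b : ℕ) (l c : List ℕ) {i : ℕ} (hi : 2 ≤ i) :
    IsStart ((b + 2) :: l) c (i + 1) ↔ IsStart ((b + 1) :: l) c i := by
  constructor <;> rintro ⟨j, h⟩ <;> refine ⟨j, ?_⟩ <;>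
    cases j <;> simp only [List.take_succ_cons, List.sum_cons, List.take_zero, List.sum_nil] at h ⊢
      <;> omega

lemma isStart_one_cons_two (l c : List ℕ) : IsStart (1 :: l) c 2 := ⟨0, Or.inr (by simp)⟩

lemma not_isStart_succ_cons_two (b : ℕ) (l c : List ℕ) : ¬ IsStart ((b + 2) :: l) c 2 := by
  rintro ⟨j, h⟩
  cases j <;> simp only [List.take_succ_cons, List.sum_cons, List.take_zero, List.sum_nil] at h
    <;> omega

/-- The size of the last block of the interleaving given by `l` and `c`. -/
def lastBlock (l c : List ℕ) : ℕ :=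
  if l.length = c.length + 1 then l.getLastD 0 else c.getLastD 0

/-- The contribution of the interleaving in which the blocks of `l` and `c` alternate, beginning
with `l`; it is zero if the numbers of blocks do not fit. -/
noncomputable def pairTerm (t : ℝ) (p : ℕ) (l c : List ℕ) (h tot : ℤ) (s : ℕ) : ℝ⟦X⟧ :=
  if l.length = c.length + 1 ∨ l.length = c.length then
    interleavingSum t p (IsStart l c) (l.sum + c.sum) (l.sum + c.sum - lastBlock l c) h tot s
  else 0

lemma getLastD_le_sum (l : List ℕ) : l.getLastD 0 ≤ l.sum := by
  rcases l.eq_nil_or_concat with rfl | ⟨L, b, rfl⟩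
  · simp
  · simp

lemma lastBlock_lt_sum {l c : List ℕ} (hl : 1 ≤ l.sum) (hc : 1 ≤ c.sum) :
    lastBlock l c < l.sum + c.sum := by
  have h1 := getLastD_le_sum l
  have h2 := getLastD_le_sum c
  unfold lastBlock
  split_ifs <;> omega

lemma pairTerm_one_cons (t : ℝ) (p : ℕ) {l c : List ℕ} (hl : 1 ≤ l.sum) (hc : 1 ≤ c.sum)
    (h tot : ℤ) (s : ℕ) :
    pairTerm t p (1 :: l) c h tot s =
      ∑ a ∈ Finset.range (s + 1), (binom a h : ℝ) • prepend t (a + 1)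
        (pairTerm t p c l (tot - a) (tot - a + (p - 1)) (s - a)) := by
  have hl0 : l ≠ [] := by rintro rfl; simp at hl
  by_cases hlen : (1 :: l).length = c.length + 1 ∨ (1 :: l).length = c.length
  · have hlen' : c.length = l.length + 1 ∨ c.length = l.length := by
      simp only [List.length_cons] at hlen; omega
    have hlast : lastBlock (1 :: l) c = lastBlock c l := by
      unfold lastBlock
      simp only [List.length_cons] at hlen ⊢
      by_cases h1 : l.length = c.length
      · rw [if_pos (by omega), if_neg (by omega)]
        cases l with
        | nil => exact absurd rfl hl0
        | cons b l => simp
      · rw [if_neg (by omega), if_pos (by omega)]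
    have hlt := lastBlock_lt_sum hc hl
    have hK : (1 :: l).sum + c.sum = (c.sum + l.sum) + 1 := by rw [List.sum_cons]; omega
    have hM : (1 :: l).sum + c.sum - lastBlock (1 :: l) c =
        (c.sum + l.sum - lastBlock c l) + 1 := by
      rw [hlast]; omega
    rw [pairTerm, if_pos hlen, hM, hK, interleavingSum_succ _ _ _ _ _ _ (by omega) (by omega)]
    refine Finset.sum_congr rfl fun a _ => ?_
    rw [pairTerm, if_pos hlen', if_pos (isStart_one_cons_two l c)]
    rw [interleavingSum_congr t p _ _ _ _ _ fun i hi => isStart_one_cons l c (by omega)]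
  · have hlen' : ¬ (c.length = l.length + 1 ∨ c.length = l.length) := by
      simp only [List.length_cons] at hlen; omega
    rw [pairTerm, if_neg hlen]
    refine (Finset.sum_eq_zero fun a _ => ?_).symm
    rw [pairTerm, if_neg hlen', map_zero, smul_zero]

lemma pairTerm_succ_cons (t : ℝ) (p b : ℕ) {l c : List ℕ} (hc : 1 ≤ c.sum) (h tot : ℤ) (s : ℕ) :
    pairTerm t p ((b + 2) :: l) c h tot s =
      ∑ a ∈ Finset.range (s + 1), (binom a h : ℝ) • prepend t (a + 1)
        (pairTerm t p ((b + 1) :: l) c (p - 1) (tot - a + (p - 1)) (s - a)) := by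
  by_cases hlen : ((b + 1) :: l).length = c.length + 1 ∨ ((b + 1) :: l).length = c.length
  · have hlen' : ((b + 2) :: l).length = c.length + 1 ∨ ((b + 2) :: l).length = c.length := hlen
    have hc0 : c ≠ [] := by rintro rfl; simp at hc
    have hlast : lastBlock ((b + 2) :: l) c = lastBlock ((b + 1) :: l) c := by
      unfold lastBlock
      simp only [List.length_cons] at hlen ⊢
      by_cases h1 : l.length = c.length
      · rw [if_pos (by omega), if_pos (by omega)]
        cases l with
        | nil => exact absurd (List.length_eq_zero_iff.1 h1.symm) hc0
        | cons b l => simp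
      · rw [if_neg (by omega), if_neg (by omega)]
    have hlt := lastBlock_lt_sum (l := (b + 1) :: l) (by rw [List.sum_cons]; omega) hc
    have hK : ((b + 2) :: l).sum + c.sum = (((b + 1) :: l).sum + c.sum) + 1 := by
      simp only [List.sum_cons]; omega
    have hM : ((b + 2) :: l).sum + c.sum - lastBlock ((b + 2) :: l) c =
        (((b + 1) :: l).sum + c.sum - lastBlock ((b + 1) :: l) c) + 1 := by
      rw [hlast]; omega
    rw [pairTerm, if_pos hlen', hM, hK, interleavingSum_succ _ _ _ _ _ _ (by omega) (by omega)]
    refine Finset.sum_congr rfl fun a _ => ?_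
    rw [pairTerm, if_pos hlen, if_neg (not_isStart_succ_cons_two b l c),
      interleavingSum_congr t p _ _ _ _ _ fun i hi => isStart_succ_cons b l c hi]
  · have hlen' : ¬ (((b + 2) :: l).length = c.length + 1 ∨ ((b + 2) :: l).length = c.length) := hlen
    rw [pairTerm, if_neg hlen']
    refine (Finset.sum_eq_zero fun a _ => ?_).symm
    rw [pairTerm, if_neg hlen, map_zero, smul_zero]

/-! ### Sums over compositions -/

/-- The list with its first entry increased by one. -/
def incHead : List ℕ → List ℕ
  | [] => []
  | b :: l => (b + 1) :: l

/-- A composition of `N + 2` either begins with `1`, or its first block can be shortened by one. -/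
lemma sum_composition_succ_succ {M : Type*} [AddCommMonoid M] (N : ℕ) (f : List ℕ → M) :
    ∑ l : Composition (N + 2), f l.blocks =
      ∑ l : Composition (N + 1), (f (1 :: l.blocks) + f (incHead l.blocks)) := by
  classical
  rw [Finset.sum_add_distrib]
  have hsum (N : ℕ) (g : List ℕ → M) : ∑ l : Composition N, g l.blocks =
      ∑ L ∈ Finset.univ.image (Composition.blocks : Composition N → List ℕ), g L :=
    (Finset.sum_image fun _ _ _ _ h => Composition.ext h).symm
  have hmem (N : ℕ) (L : List ℕ) :
      L ∈ Finset.univ.image (Composition.blocks : Composition N → List ℕ) ↔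
        (∀ i ∈ L, 0 < i) ∧ L.sum = N := by
    rw [Finset.mem_image]
    constructor
    · rintro ⟨l, -, rfl⟩
      exact ⟨fun i hi => l.blocks_pos hi, l.blocks_sum⟩
    · rintro ⟨h1, h2⟩
      exact ⟨⟨L, fun {i} hi => h1 i hi, h2⟩, Finset.mem_univ _, rfl⟩
  rw [hsum (N + 2) f, hsum (N + 1) fun L => f (1 :: L), hsum (N + 1) fun L => f (incHead L)]
  set A := Finset.univ.image (Composition.blocks : Composition (N + 1) → List ℕ) with hA
  have hinj : Set.InjOn incHead (A : Set (List ℕ)) := by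
    intro L hL L' hL' h
    cases L <;> cases L' <;> simp_all [incHead]
  rw [← Finset.sum_image (s := A) (g := fun L => 1 :: L) (f := f)
      (fun _ _ _ _ h => List.tail_eq_of_cons_eq h),
    ← Finset.sum_image (s := A) (g := incHead) (f := f) hinj, ← Finset.sum_union]
  · congr 1
    ext L
    rw [hmem, Finset.mem_union, Finset.mem_image, Finset.mem_image]
    constructor
    · rintro ⟨h1, h2⟩
      match L, h1, h2 with
      | [], _, h2 => simp at h2
      | 0 :: L, h1, _ => exact absurd (h1 0 List.mem_cons_self) (lt_irrefl 0)
      | 1 :: L, h1, h2 =>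
        refine Or.inl ⟨L, (hmem _ _).2 ⟨fun i hi => h1 i (List.mem_cons_of_mem _ hi), ?_⟩, rfl⟩
        rw [List.sum_cons] at h2; omega
      | (b + 2) :: L, h1, h2 =>
        refine Or.inr ⟨(b + 1) :: L, (hmem _ _).2 ⟨fun i hi => ?_, ?_⟩, rfl⟩
        · rcases List.mem_cons.1 hi with rfl | hi
          · omega
          · exact h1 i (List.mem_cons_of_mem _ hi)
        · rw [List.sum_cons] at h2 ⊢; omega
    · rintro (⟨L, hL, rfl⟩ | ⟨L, hL, rfl⟩)
      · obtain ⟨h1, h2⟩ := (hmem _ _).1 hL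
        refine ⟨fun i hi => ?_, by rw [List.sum_cons]; omega⟩
        rcases List.mem_cons.1 hi with rfl | hi
        · omega
        · exact h1 i hi
      · obtain ⟨h1, h2⟩ := (hmem _ _).1 hL
        cases L with
        | nil => simp at h2
        | cons b L =>
          refine ⟨fun i hi => ?_, by simp only [incHead, List.sum_cons] at h2 ⊢; omega⟩
          rcases List.mem_cons.1 hi with rfl | hi
          · omega
          · exact h1 i (List.mem_cons_of_mem _ hi)
  · rw [Finset.disjoint_left]
    intro L h1 h2
    rw [Finset.mem_image] at h1 h2
    obtain ⟨L1, -, rfl⟩ := h1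
    obtain ⟨L2, hL2, h⟩ := h2
    cases L2 with
    | nil => simp [incHead] at h
    | cons b L2 =>
      have := ((hmem _ _).1 hL2).1 b List.mem_cons_self
      simp only [incHead, List.cons.injEq] at h
      omega

/-- The sum of the contributions of all interleavings that begin with the first word, which has `N`
letters `y`, the second word having `M`. -/
noncomputable def pairSum (t : ℝ) (p N M : ℕ) (h tot : ℤ) (s : ℕ) : ℝ⟦X⟧ :=
  ∑ l : Composition N, ∑ c : Composition M, pairTerm t p l.blocks c.blocks h tot s

lemma pairSum_succ_succ (t : ℝ) (p n v : ℕ) (h tot : ℤ) (s : ℕ) :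
    pairSum t p (n + 2) (v + 1) h tot s =
      ∑ a ∈ Finset.range (s + 1), (binom a h : ℝ) • prepend t (a + 1)
        (pairSum t p (n + 1) (v + 1) (p - 1) (tot - a + (p - 1)) (s - a) +
          pairSum t p (v + 1) (n + 1) (tot - a) (tot - a + (p - 1)) (s - a)) := by
  have h1 (l : Composition (n + 1)) (c : Composition (v + 1)) :
      pairTerm t p (1 :: l.blocks) c.blocks h tot s = _ :=
    pairTerm_one_cons t p (by rw [l.blocks_sum]; omega) (by rw [c.blocks_sum]; omega) h tot s
  have h2 (l : Composition (n + 1)) (c : Composition (v + 1)) :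
      pairTerm t p (incHead l.blocks) c.blocks h tot s =
        ∑ a ∈ Finset.range (s + 1), (binom a h : ℝ) • prepend t (a + 1)
          (pairTerm t p l.blocks c.blocks (p - 1) (tot - a + (p - 1)) (s - a)) := by
    have hsum := l.blocks_sum
    have hpos : ∀ i ∈ l.blocks, 0 < i := fun i hi => l.blocks_pos hi
    generalize l.blocks = L at hsum hpos
    match L, hsum, hpos with
    | [], hsum, _ => simp at hsum
    | 0 :: L, _, hpos => exact absurd (hpos 0 List.mem_cons_self) (lt_irrefl 0)
    | (b + 1) :: L, _, _ => exact pairTerm_succ_cons t p b (by rw [c.blocks_sum]; omega) h tot s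
  rw [pairSum, sum_composition_succ_succ n fun L =>
    ∑ c : Composition (v + 1), pairTerm t p L c.blocks h tot s]
  simp only [h1, h2, pairSum, map_add, map_sum, smul_add, Finset.smul_sum, Finset.sum_add_distrib]
  rw [add_comm]
  congr 1
  · exact (Finset.sum_congr rfl fun l _ => Finset.sum_comm).trans Finset.sum_comm
  · refine ((Finset.sum_congr rfl fun l _ => Finset.sum_comm).trans Finset.sum_comm).trans ?_
    exact Finset.sum_congr rfl fun a _ => Finset.sum_comm

lemma pairSum_one (t : ℝ) (p v : ℕ) (h tot : ℤ) (s : ℕ) :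
    pairSum t p 1 (v + 1) h tot s =
      interleavingSum t p (IsStart [1] [v + 1]) (v + 2) 1 h tot s := by
  have hl (l : Composition 1) : l = Composition.single 1 one_pos := by
    rw [Composition.eq_single_iff_length]
    have h1 := l.length_le
    have h2 := l.length_pos_of_pos one_pos
    omega
  rw [pairSum, Finset.sum_eq_single (Composition.single 1 one_pos)
    (fun l _ hne => absurd (hl l) hne)
    (by simp), Finset.sum_eq_single (Composition.single (v + 1) v.succ_pos)]
  · simp [pairTerm, Composition.single, lastBlock, show 1 + (v + 1) = v + 2 by ring]
  · intro c _ hne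
    have hc := c.length_pos_of_pos v.succ_pos
    have hc1 : c.length ≠ 1 := fun h => hne ((Composition.eq_single_iff_length v.succ_pos).2 h)
    rw [pairTerm, if_neg]
    simp only [Composition.single_length, Composition.blocks_length]
    omega
  · simp

lemma pairSum_of_neg (t : ℝ) {p : ℕ} (hp : 1 ≤ p) (n v : ℕ) (h tot : ℤ) (s : ℕ)
    (hs : (s : ℤ) = tot + (n + v) * (p - 1)) (h0 : h < 0) :
    pairSum t p (n + 1) (v + 1) h tot s = 0 := by
  cases n with
  | zero =>
    rw [pairSum_one, interleavingSum_one t hp _ v h tot s (by simpa using hs)]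
    refine Finset.sum_eq_zero fun a _ => ?_
    rw [binom_of_neg a h0]; simp
  | succ n =>
    rw [pairSum_succ_succ]
    refine Finset.sum_eq_zero fun a _ => ?_
    rw [binom_of_neg a h0, Nat.cast_zero, zero_smul]

/-- An interleaving in which a word would need a negative number of letters `x` contributes
nothing. -/
lemma pairSum_eq_zero (t : ℝ) {p : ℕ} (hp : 1 ≤ p) (n v : ℕ) (h tot : ℤ) (s : ℕ)
    (hs : (s : ℤ) = tot + (n + v) * (p - 1)) (hneg : h < 0 ∨ tot < h) :
    pairSum t p (n + 1) (v + 1) h tot s = 0 := by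
  induction n generalizing h tot s with
  | zero =>
    rw [pairSum_one, interleavingSum_one t hp _ v h tot s (by simpa using hs)]
    refine Finset.sum_eq_zero fun a _ => ?_
    split_ifs with ha
    · have : binom a h = 0 := by
        rcases hneg with h0 | h0
        · exact binom_of_neg a h0
        · exact binom_of_lt (by omega)
      rw [this, Nat.cast_zero, zero_smul]
    · rfl
  | succ n ih =>
    rcases hneg with h0 | h0
    · exact pairSum_of_neg t hp (n + 1) v h tot s hs h0
    · rw [pairSum_succ_succ]
      refine Finset.sum_eq_zero fun a ha => ?_
      have ha : a < s + 1 := Finset.mem_range.1 ha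
      by_cases hah : (a : ℤ) < h
      · rw [binom_of_lt hah, Nat.cast_zero, zero_smul]
      · have hs' : ((s - a : ℕ) : ℤ) = (tot - a + (p - 1)) + (n + v) * (p - 1) := by
          rw [Nat.cast_sub (by omega), hs]; push_cast; ring
        rw [ih _ _ _ hs' (Or.inr (by omega)),
          pairSum_of_neg t hp v n _ _ _ (by rw [hs']; ring) (by omega), add_zero, map_zero,
          smul_zero]

/-- The combinatorial core: iterating the one-step shuffle formula produces the sum over pairs of
compositions. -/
lemma halfShuffle_eq_pairSum (t : ℝ) {p : ℕ} (hp : 1 ≤ p) (n v a b s : ℕ)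
    (hs : s = a + b + (n + v) * (p - 1)) :
    halfShuffle (innerSeries t (List.replicate n p)) (innerSeries t (List.replicate v p)) a b =
      pairSum t p (n + 1) (v + 1) a (a + b) s := by
  obtain ⟨q, rfl⟩ := Nat.exists_eq_add_of_le' hp
  rw [Nat.add_sub_cancel] at hs
  induction hk : n + v using Nat.strong_induction_on generalizing n v a b s with
  | _ k ih =>
  cases n with
  | zero =>
    rw [List.replicate_zero, halfShuffle_innerSeries_nil, pairSum_one,
      interleavingSum_one t hp _ v _ _ s (by rw [hs]; push_cast; ring)]
    have hle : a + b + 1 ≤ s + 1 := by rw [hs]; omega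
    rw [← Finset.sum_subset (Finset.range_subset_range.2 hle)]
    · refine Finset.sum_congr rfl fun α hα => ?_
      have hα : α < a + b + 1 := Finset.mem_range.1 hα
      have htot : ((a : ℤ) + b).toNat = a + b := by omega
      rw [if_pos (by omega), binom_natCast, htot]
    · intro α _ hα
      rw [Finset.mem_range] at hα
      rw [if_neg (by omega)]
  | succ n =>
    have hle : a + b + 1 ≤ s + 1 := by rw [hs]; omega
    rw [List.replicate_succ, halfShuffle_innerSeries_cons, pairSum_succ_succ,
      ← Finset.sum_subset (Finset.range_subset_range.2 hle)]
    · refine Finset.sum_congr rfl fun α hα => ?_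
      have hα : α < a + b + 1 := Finset.mem_range.1 hα
      have hs1 : s - α = q + (a + b - α) + (n + v) * q := by
        have : (n + 1 + v) * q = q + (n + v) * q := by ring
        omega
      have hs2 : s - α = (a + b - α) + q + (v + n) * q := by rw [hs1]; ring
      rw [polylog_mul_polylog, ih (n + v) (by omega) n v q (a + b - α) (s - α) hs1 rfl,
        ih (v + n) (by omega) v n (a + b - α) q (s - α) hs2 rfl, binom_natCast]
      have e1 : ((q + 1 : ℕ) : ℤ) - 1 = q := by push_cast; ring
      have e2 : ((a + b - α : ℕ) : ℤ) = a + b - α := by omega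
      have e3 : (q : ℤ) + (a + b - α) = a + b - α + q := by ring
      rw [e1, e2, e3]
    · intro α hα hα'
      rw [Finset.mem_range] at hα hα'
      have hs' : ((s - α : ℕ) : ℤ) =
          ((a : ℤ) + b - α + ((q + 1 : ℕ) - 1)) + (n + v) * ((q + 1 : ℕ) - 1) := by
        rw [Nat.cast_sub (by omega), hs]; push_cast; ring
      rw [pairSum_eq_zero t hp n v _ _ _ hs' (Or.inr (by omega)),
        pairSum_of_neg t hp v n _ _ _ (by rw [hs']; ring) (by omega), add_zero, map_zero,
          smul_zero]

/-! ### Evaluation at `z = 1` and conclusion -/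

lemma mem_blockStarts_iff {a b : ℕ} (l : Composition a) (c : Composition b)
    (hlen : l.length = c.length + 1 ∨ l.length = c.length) {i : ℕ} (hi : i ≤ a + b) :
    i ∈ blockStarts l.sizeUpTo c.sizeUpTo c.length ↔ IsStart l.blocks c.blocks i := by
  simp only [blockStarts, Finset.mem_union, Finset.mem_image, Finset.mem_range]
  constructor
  · rintro (⟨j, -, rfl⟩ | ⟨j, -, rfl⟩)
    · exact ⟨j, Or.inl rfl⟩
    · exact ⟨j, Or.inr rfl⟩
  · -- Beyond the lengths of the compositions the partial sums are constant, and the values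
    -- exceed `a + b`.
    rintro ⟨j, h | h⟩
    · by_cases hj : j < c.length + 1
      · exact Or.inl ⟨j, hj, h.symm⟩
      · have h1 : (l.blocks.take j).sum = a := l.sizeUpTo_ofLength_le j (by omega)
        have h2 : (c.blocks.take j).sum = b := c.sizeUpTo_ofLength_le j (by omega)
        omega
    · by_cases hj : j < c.length
      · exact Or.inr ⟨j, hj, h.symm⟩
      · have h1 : (l.blocks.take (j + 1)).sum = a := l.sizeUpTo_ofLength_le _ (by omega)
        have h2 : (c.blocks.take j).sum = b := c.sizeUpTo_ofLength_le j (by omega)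
        omega

lemma lowerEntry_eq_entry {a b : ℕ} (l : Composition a) (c : Composition b)
    (hlen : l.length = c.length + 1 ∨ l.length = c.length) (h m u p : ℕ) (α : ℕ → ℕ) {i : ℕ}
    (hi : i ≤ a + b) :
    lowerEntry l.sizeUpTo c.sizeUpTo c.length h m u p α i =
      entry (IsStart l.blocks c.blocks) ((h : ℤ) - 1) ((m : ℤ) + u - 2) p α i := by
  classical
  unfold lowerEntry entry
  refine if_congr Iff.rfl rfl (if_congr (mem_blockStarts_iff l c hlen hi) ?_ rfl)
  ring

lemma getLastD_add_sizeUpTo {a : ℕ} (l : Composition a) {k : ℕ} (hk : l.length = k + 1) :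
    l.blocks.getLastD 0 = part l (k + 1) ∧ l.sizeUpTo k + part l (k + 1) = a := by
  have hlt : k < l.length := by omega
  have h1 : part l (k + 1) = l.blocks[k] := by
    rw [part, Nat.add_sub_cancel, List.getD_eq_getElem]
  constructor
  · rw [h1, List.getLastD_eq_getLast?, List.getLast?_eq_getElem?]
    have : l.blocks.length - 1 = k := by rw [Composition.blocks_length]; omega
    rw [this, List.getElem?_eq_getElem (by rw [Composition.blocks_length]; omega)]
    rfl
  · rw [h1, ← Composition.sizeUpTo_succ l hlt]
    exact l.sizeUpTo_ofLength_le _ (by omega)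

lemma part_le {a : ℕ} (l : Composition a) (k : ℕ) : part l k ≤ a := by
  rw [part]
  by_cases hk : k - 1 < l.blocks.length
  · rw [List.getD_eq_getElem _ _ hk]
    exact (List.le_sum_of_mem (List.getElem_mem hk)).trans_eq l.blocks_sum
  · rw [List.getD_eq_default _ _ (by omega)]
    exact Nat.zero_le a

/-- The series whose value at `z = 1` is `corrected α K k`. -/
noncomputable def correctedSeries (t : ℝ) (α : ℕ → ℕ) (K k : ℕ) : ℝ⟦X⟧ :=
  polylog t (shifted α 1 K) - t • polylog t (merged α K k)

lemma pairTerm_eq_of_length (t : ℝ) (p : ℕ) {n v : ℕ} (l : Composition (n + 1))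
    (c : Composition (v + 1)) (hlen : l.length = c.length + 1 ∨ l.length = c.length) (h m u s : ℕ)
    {K M r : ℕ} (hK : K = n + v + 2) (hr : lastBlock l.blocks c.blocks = r) (hM : M + r = K) :
    pairTerm t p l.blocks c.blocks ((h : ℤ) - 1) ((m : ℤ) + u - 2) s =
      ∑ α ∈ Finset.piAntidiag (Finset.Icc 1 K) s,
        (coeff K M p (lowerEntry l.sizeUpTo c.sizeUpTo c.length h m u p α) α : ℝ) •
          correctedSeries t α K (K - r) := by
  have hsum : l.blocks.sum + c.blocks.sum = K := by rw [l.blocks_sum, c.blocks_sum, hK]; omega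
  rw [pairTerm, if_pos (by simpa using hlen), hsum, hr, interleavingSum]
  refine Finset.sum_congr rfl fun α _ => ?_
  have hM' : K - r = M := by omega
  rw [correctedSeries, hM']
  congr 2
  refine coeff_congr fun i _ hi => (lowerEntry_eq_entry l c hlen h m u p α ?_).symm
  omega

/-- The contribution of a pair of compositions, in the two cases that the formula
distinguishes: the interleaving ends with a block of the first or of the second word. -/
lemma pairTerm_eq_sum (t : ℝ) (p : ℕ) {n v : ℕ} (l : Composition (n + 1)) (c : Composition (v + 1))
    (h m u s K : ℕ) (hK : K = n + v + 2) :
    pairTerm t p l.blocks c.blocks ((h : ℤ) - 1) ((m : ℤ) + u - 2) s =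
      ∑ α ∈ Finset.piAntidiag (Finset.Icc 1 K) s,
        ((if l.length = c.length + 1 then
          (coeff K (l.sizeUpTo c.length + v + 1) p
            (lowerEntry l.sizeUpTo c.sizeUpTo c.length h m u p α) α : ℝ) •
              correctedSeries t α K (K - part l (c.length + 1)) else 0) +
        if l.length = c.length then
          (coeff K (n + c.sizeUpTo (c.length - 1) + 1) p
            (lowerEntry l.sizeUpTo c.sizeUpTo c.length h m u p α) α : ℝ) •
              correctedSeries t α K (K - part c c.length) else 0) := by
  by_cases h1 : l.length = c.length + 1
  · obtain ⟨e1, e2⟩ := getLastD_add_sizeUpTo l h1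
    simp only [if_pos h1, if_neg (show ¬ l.length = c.length by omega), add_zero]
    refine pairTerm_eq_of_length t p l c (Or.inl h1) h m u s hK ?_ (by omega)
    rw [lastBlock, if_pos (by simpa using h1), e1]
  by_cases h2 : l.length = c.length
  · obtain ⟨k, hk⟩ := Nat.exists_eq_add_of_le' (c.length_pos_of_pos v.succ_pos)
    obtain ⟨e1, e2⟩ := getLastD_add_sizeUpTo c hk
    simp only [if_neg h1, if_pos h2, zero_add]
    refine pairTerm_eq_of_length t p l c (Or.inr h2) h m u s hK ?_ ?_
    · rw [lastBlock, if_neg (by simpa using h1), e1, hk]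
    · rw [hk, Nat.add_sub_cancel]
      change n + c.sizeUpTo k + 1 + part c (k + 1) = K
      omega
  · simp only [if_neg h1, if_neg h2, add_zero, Finset.sum_const_zero]
    rw [pairTerm, if_neg]
    simp only [Composition.blocks_length]
    omega

lemma admissible_shifted {α : ℕ → ℕ} {K : ℕ} (hα : 1 ≤ α 1) (hK : 1 ≤ K) :
    Admissible (shifted α 1 K) := by
  rw [shifted_eq_cons α hK]
  refine ⟨by omega, fun j hj => ?_⟩
  rw [shifted, List.mem_map] at hj
  obtain ⟨i, -, rfl⟩ := hj
  omega

lemma admissible_merged {α : ℕ → ℕ} {K k : ℕ} (hα : 1 ≤ α 1) (hk : 1 ≤ k) :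
    Admissible (merged α K k) := by
  have hpos : ∀ a b, ∀ j ∈ shifted α a b, 1 ≤ j := by
    intro a b j hj
    rw [shifted, List.mem_map] at hj
    obtain ⟨i, -, rfl⟩ := hj
    omega
  rcases Nat.eq_or_lt_of_le hk with rfl | hk
  · have : shifted α 1 (1 - 1) = [] := by simp [shifted]
    rw [merged, this]
    exact ⟨by omega, hpos _ _⟩
  · rw [merged, shifted_eq_cons α (by omega), List.cons_append]
    refine ⟨by omega, fun j hj => ?_⟩
    rcases List.mem_append.1 hj with hj | hj
    · exact hpos _ _ j hj
    · rcases List.mem_cons.1 hj with rfl | hj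
      · omega
      · exact hpos _ _ j hj

/-- If `α₁ = 0`, the series need not converge, but then the coefficient vanishes. -/
lemma hasSum_coeff_smul_correctedSeries (t : ℝ) (p : ℕ) {K M k : ℕ} (b : ℕ → ℤ) (α : ℕ → ℕ)
    (hb : 1 ≤ b 1) (hK : 1 ≤ K) (hM : 1 ≤ M) (hk : 1 ≤ k) :
    HasSum (fun n => PowerSeries.coeff n ((coeff K M p b α : ℝ) • correctedSeries t α K k))
      (((coeff K M p b α : Polynomial ℝ) * corrected α K k).eval t) := by
  rcases Nat.eq_zero_or_pos (coeff K M p b α) with h0 | h0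
  · simp only [h0, Nat.cast_zero, zero_smul, map_zero, zero_mul, Polynomial.eval_zero]
    exact hasSum_zero
  · have hα : 1 ≤ α 1 := by
      by_contra hα
      refine h0.ne' (mul_eq_zero_of_left (Finset.prod_eq_zero (i := 1) ?_ ?_) _)
      · simpa using hM
      · exact binom_of_lt (by omega)
    simp only [correctedSeries, corrected, map_smul, map_sub, smul_eq_mul, Polynomial.eval_mul,
      Polynomial.eval_natCast, Polynomial.eval_sub, Polynomial.eval_X]
    exact ((hasSum_coeff_polylog t (admissible_shifted hα hK)).sub
      ((hasSum_coeff_polylog t (admissible_merged hα hk)).mul_left t)).mul_left _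

lemma hasSum_coeff_ite (t : ℝ) {P : Prop} [Decidable P] {f : ℝ⟦X⟧} {g : Polynomial ℝ}
    (h : P → HasSum (fun n => PowerSeries.coeff n f) (g.eval t)) :
    HasSum (fun n => PowerSeries.coeff n (if P then f else 0)) ((if P then g else 0).eval t) := by
  split_ifs with hP
  · exact h hP
  · simp

/-- The right hand side of the product formula, as a power series. -/
lemma polylog_replicate_mul (t : ℝ) (m u p n v : ℕ) (hm : 2 ≤ m) (hu : 2 ≤ u) (hp : 1 ≤ p) :
    polylog t (m :: List.replicate n p) * polylog t (u :: List.replicate v p) =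
      ∑ α ∈ Finset.piAntidiag (Finset.Icc 1 (n + v + 2)) ((n + v) * (p - 1) + (m + u) - 2),
        ((∑ l : Composition (n + 1), ∑ c : Composition (v + 1),
            if l.length = c.length + 1 then
              (coeff (n + v + 2) (l.sizeUpTo c.length + v + 1) p
                  (beta l c c.length m u p α) α : ℝ) •
                correctedSeries t α (n + v + 2) (n + v + 2 - part l (c.length + 1))
            else 0) +
          (∑ l : Composition (n + 1), ∑ c : Composition (v + 1),
            if l.length = c.length then
              (coeff (n + v + 2) (n + c.sizeUpTo (c.length - 1) + 1) p
                  (beta l c c.length m u p α) α : ℝ) •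
                correctedSeries t α (n + v + 2) (n + v + 2 - part c c.length)
            else 0) +
          (∑ l : Composition (n + 1), ∑ c : Composition (v + 1),
            if c.length = l.length + 1 then
              (coeff (n + v + 2) (c.sizeUpTo l.length + n + 1) p
                  (gamma l c l.length m u p α) α : ℝ) •
                correctedSeries t α (n + v + 2) (n + v + 2 - part c (l.length + 1))
            else 0) +
          (∑ l : Composition (n + 1), ∑ c : Composition (v + 1),
            if l.length = c.length then
              (coeff (n + v + 2) (v + l.sizeUpTo (l.length - 1) + 1) p
                  (gamma l c l.length m u p α) α : ℝ) •
                correctedSeries t α (n + v + 2) (n + v + 2 - part l l.length)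
            else 0)) := by
  set s := (n + v) * (p - 1) + (m + u) - 2 with hs
  have hsplit := polylog_mul_polylog t (m - 1) (u - 1) (List.replicate n p) (List.replicate v p)
  rw [Nat.sub_add_cancel (by omega), Nat.sub_add_cancel (by omega)] at hsplit
  have e1 : ((m - 1 : ℕ) : ℤ) = m - 1 := by omega
  have e2 : ((u - 1 : ℕ) : ℤ) = u - 1 := by omega
  have e3 : (m : ℤ) - 1 + (u - 1) = m + u - 2 := by ring
  have e4 : (u : ℤ) - 1 + (m - 1) = m + u - 2 := by ring
  rw [hsplit, halfShuffle_eq_pairSum t hp n v _ _ s (by omega),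
    halfShuffle_eq_pairSum t hp v n _ _ s (by rw [add_comm v n]; omega), e1, e2, e3, e4]
  have h1 : pairSum t p (n + 1) (v + 1) (m - 1) (m + u - 2) s = _ :=
    Finset.sum_congr rfl fun l _ => Finset.sum_congr rfl fun c _ =>
      pairTerm_eq_sum t p l c m m u s (n + v + 2) rfl
  have h2 : pairSum t p (v + 1) (n + 1) (u - 1) (m + u - 2) s = _ :=
    Finset.sum_congr rfl fun c _ => Finset.sum_congr rfl fun l _ =>
      pairTerm_eq_sum t p c l u m u s (n + v + 2) (by ring)
  have h1' := h1.trans ((Finset.sum_congr rfl fun l _ => Finset.sum_comm).trans Finset.sum_comm)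
  have h2' := h2.trans (Finset.sum_comm.trans
    ((Finset.sum_congr rfl fun l _ => Finset.sum_comm).trans Finset.sum_comm))
  rw [h1', h2', ← Finset.sum_add_distrib]
  refine Finset.sum_congr rfl fun α _ => ?_
  simp only [Finset.sum_add_distrib, ← add_assoc, beta, gamma]
  congr 1
  refine Finset.sum_congr rfl fun l _ => Finset.sum_congr rfl fun c _ => ?_
  exact if_congr eq_comm rfl rfl

lemma hasSum_halfShuffle_geom (a b : ℕ) (ha : 1 ≤ a) :
    HasSum (fun n => PowerSeries.coeff n (halfShuffle (innerSeries 0 []) (innerSeries 0 []) a b))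
      (∑ k ∈ Finset.Icc 1 (b + 1), ((a + b + 1 - k).choose a : ℝ) * mzv [a + b + 2 - k, k]) := by
  have hsum : ∑ k ∈ Finset.Icc 1 (b + 1), ((a + b + 1 - k).choose a : ℝ) * mzv [a + b + 2 - k, k] =
      ∑ α ∈ Finset.range (a + b + 1), (α.choose a : ℝ) * mzv [α + 1, a + b - α + 1] := by
    have hsub : Finset.Ico a (a + b + 1) ⊆ Finset.range (a + b + 1) := fun α hα => by
      rw [Finset.mem_Ico] at hα
      rw [Finset.mem_range]; omega
    rw [← Finset.sum_subset hsub]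
    · refine Finset.sum_bij' (fun k _ => a + b + 1 - k) (fun α _ => a + b + 1 - α) ?_ ?_ ?_ ?_ ?_
      all_goals
        intro k hk
        first
        | rw [Finset.mem_Icc] at hk
        | rw [Finset.mem_Ico] at hk
      · rw [Finset.mem_Ico]; omega
      · rw [Finset.mem_Icc]; omega
      · omega
      · omega
      · have h1 : a + b + 1 - k + 1 = a + b + 2 - k := by omega
        have h2 : a + b - (a + b + 1 - k) + 1 = k := by omega
        rw [h1, h2]
    · intro α hα hα'
      rw [Finset.mem_range] at hα
      rw [Finset.mem_Ico] at hα'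
      rw [Nat.choose_eq_zero_of_lt (by omega), Nat.cast_zero, zero_mul]
  rw [hsum, halfShuffle_innerSeries_nil]
  simp only [map_sum, map_smul, smul_eq_mul, zero_smul, sub_zero]
  refine hasSum_sum fun α _ => ?_
  rcases Nat.lt_or_ge α a with h | h
  · simp only [Nat.choose_eq_zero_of_lt h, Nat.cast_zero, zero_mul]
    exact hasSum_zero
  · refine (hasSum_coeff_polylog_zero ?_).mul_left _
    exact ⟨by omega, by simp⟩

/-- Euler's decomposition formula. -/
lemma mzv_mul_mzv (m u : ℕ) (hm : 2 ≤ m) (hu : 2 ≤ u) :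
    mzv [m] * mzv [u] =
      ∑ k ∈ Finset.Icc 1 m, ((m + u - k - 1).choose (u - 1) : ℝ) * mzv [m + u - k, k] +
        ∑ k ∈ Finset.Icc 1 u, ((m + u - k - 1).choose (m - 1) : ℝ) * mzv [m + u - k, k] := by
  obtain ⟨a, rfl⟩ := Nat.exists_eq_add_of_le' (show 1 ≤ m by omega)
  obtain ⟨b, rfl⟩ := Nat.exists_eq_add_of_le' (show 1 ≤ u by omega)
  have hadm (k : ℕ) (hk : 2 ≤ k) : Admissible [k] := ⟨hk, by simp⟩
  have h1 := hasSum_coeff_mul (hasSum_coeff_polylog_zero (hadm (a + 1) hm))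
    (hasSum_coeff_polylog_zero (hadm (b + 1) hu))
  have h2 := (hasSum_halfShuffle_geom b a (by omega)).add (hasSum_halfShuffle_geom a b (by omega))
  rw [polylog_mul_polylog, add_comm (halfShuffle _ _ _ _)] at h1
  refine (h1.unique (by simpa only [map_add] using h2)).trans ?_
  congr 1
  · refine Finset.sum_congr rfl fun k _ => ?_
    rw [show b + a + 1 - k = a + 1 + (b + 1) - k - 1 by omega,
      show b + a + 2 - k = a + 1 + (b + 1) - k by omega, Nat.add_sub_cancel]
  · refine Finset.sum_congr rfl fun k _ => ?_
    rw [show a + b + 1 - k = a + 1 + (b + 1) - k - 1 by omega,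
      show a + b + 2 - k = a + 1 + (b + 1) - k by omega, Nat.add_sub_cancel]

end InterpolatedMZV

theorem theorem1 (m u p n v : ℕ) (hm : 2 ≤ m) (hu : 2 ≤ u) (hp : 1 ≤ p) :
    (imzv (m :: List.replicate n p) * imzv (u :: List.replicate v p) =
      ∑ α ∈ Finset.piAntidiag (Finset.Icc 1 (n + v + 2)) ((n + v) * (p - 1) + (m + u) - 2),
        ((∑ l : Composition (n + 1), ∑ c : Composition (v + 1),
            if l.length = c.length + 1 then
              (coeff (n + v + 2) (l.sizeUpTo c.length + v + 1) p
                  (beta l c c.length m u p α) α : Polynomial ℝ) *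
                corrected α (n + v + 2) (n + v + 2 - part l (c.length + 1))
            else 0) +
          (∑ l : Composition (n + 1), ∑ c : Composition (v + 1),
            if l.length = c.length then
              (coeff (n + v + 2) (n + c.sizeUpTo (c.length - 1) + 1) p
                  (beta l c c.length m u p α) α : Polynomial ℝ) *
                corrected α (n + v + 2) (n + v + 2 - part c c.length)
            else 0) +
          (∑ l : Composition (n + 1), ∑ c : Composition (v + 1),
            if c.length = l.length + 1 then
              (coeff (n + v + 2) (c.sizeUpTo l.length + n + 1) p
                  (gamma l c l.length m u p α) α : Polynomial ℝ) *
                corrected α (n + v + 2) (n + v + 2 - part c (l.length + 1))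
            else 0) +
          (∑ l : Composition (n + 1), ∑ c : Composition (v + 1),
            if l.length = c.length then
              (coeff (n + v + 2) (v + l.sizeUpTo (l.length - 1) + 1) p
                  (gamma l c l.length m u p α) α : Polynomial ℝ) *
                corrected α (n + v + 2) (n + v + 2 - part l l.length)
            else 0))) ∧
    mzv [m] * mzv [u] =
      ∑ k ∈ Finset.Icc 1 m, ((m + u - k - 1).choose (u - 1) : ℝ) * mzv [m + u - k, k] +
        ∑ k ∈ Finset.Icc 1 u, ((m + u - k - 1).choose (m - 1) : ℝ) * mzv [m + u - k, k] := by

  refine ⟨Polynomial.funext fun t => ?_, mzv_mul_mzv m u hm hu⟩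
  have hadm (k n : ℕ) (hk : 2 ≤ k) : Admissible (k :: List.replicate n p) :=
    ⟨hk, fun j hj => by rw [List.eq_of_mem_replicate hj]; exact hp⟩
  have hL := hasSum_coeff_mul (hasSum_coeff_polylog t (hadm m n hm))
    (hasSum_coeff_polylog t (hadm u v hu))
  rw [Polynomial.eval_mul]
  refine hL.unique ?_
  rw [polylog_replicate_mul t m u p n v hm hu hp]
  simp only [map_sum, map_add, Polynomial.eval_finsetSum, Polynomial.eval_add]
  have hb (l : Composition (n + 1)) (c : Composition (v + 1)) (q : ℕ) (α : ℕ → ℕ) :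
      1 ≤ beta l c q m u p α 1 := by
    rw [beta, lowerEntry, if_pos rfl]; omega
  have hc (l : Composition (n + 1)) (c : Composition (v + 1)) (q : ℕ) (α : ℕ → ℕ) :
      1 ≤ gamma l c q m u p α 1 := by
    rw [gamma, lowerEntry, if_pos rfl]; omega
  refine hasSum_sum fun α _ => ((HasSum.add ?_ ?_).add ?_).add ?_
  · refine hasSum_sum fun l _ => hasSum_sum fun c _ => hasSum_coeff_ite t fun _ => ?_
    have := part_le l (c.length + 1)
    exact hasSum_coeff_smul_correctedSeries t p _ α (hb l c _ α) (by omega) (by omega) (by omega)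
  · refine hasSum_sum fun l _ => hasSum_sum fun c _ => hasSum_coeff_ite t fun _ => ?_
    have := part_le c c.length
    exact hasSum_coeff_smul_correctedSeries t p _ α (hb l c _ α) (by omega) (by omega) (by omega)
  · refine hasSum_sum fun l _ => hasSum_sum fun c _ => hasSum_coeff_ite t fun _ => ?_
    have := part_le c (l.length + 1)
    exact hasSum_coeff_smul_correctedSeries t p _ α (hc l c _ α) (by omega) (by omega) (by omega)
  · refine hasSum_sum fun l _ => hasSum_sum fun c _ => hasSum_coeff_ite t fun _ => ?_
    have := part_le l l.length
    exact hasSum_coeff_smul_correctedSeries t p _ α (hc l c _ α) (by omega) (by omega) (by omega)
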